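/- Let $n\in\mathbb N$, and for $\alpha\in\mathbb R$ let $w_\alpha(x)=(1+|x|^2)^{\alpha/2}$, $x\in\mathbb R^n$. Let $F$, $Ff=\widehat f$, denote the Fourier transform on the space $\mathcal S'(\mathbb R^n)$ of (complex-valued) tempered distributions, extending $\widehat f(\xi)=\int_{\mathbb R^n}f(x)e^{-2\pi i x\cdot\xi}\,dx$ from the Schwartz space $\mathcal S(\mathbb R^n)$, and let $f\mapsto f^\vee$ denote its inverse. Let $\varphi_0\in\mathcal S(\mathbb R^n)$ satisfy $\varphi_0(x)=1$ for $|x|\le 1$ and $\varphi_0(x)=0$ for $|x|\ge 3/2$, and put $\varphi_j(x)=\varphi_0(2^{-j}x)-\varphi_0(2^{-j+1}x)$ for $j\ge1$. For $s,\alpha\in\mathbb R$ let $H^s(\mathbb R^n,w_\alpha)=B^s_{2,2}(\mathbb R^n,w_\alpha)$ be the space of all $f\in\mathcal S'(\mathbb R^n)$ with $$\|f\,|\,H^s(\mathbb R^n,w_\alpha)\|_{\varphi_0}=\Big(\sum_{j=0}^\infty 2^{2js}\,\big\|w_\alpha\,(\varphi_j\widehat f\,)^\vee\,\big|\,L_2(\mathbb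 R^n)\big\|^2\Big)^{1/2}<\infty .$$ **Proposition 1.1.** Let $s,\alpha\in\mathbb R$. Then the Fourier transform is an isomorphic mapping of $H^s(\mathbb R^n,w_\alpha)$ onto $H^\alpha(\mathbb R^n,w_s)$. That is, for any $\varphi_0$ and $\psi_0$ as above, where $\varphi_0$ is used to define $H^s(\mathbb R^n,w_\alpha)$ and $\psi_0$ to define $H^\alpha(\mathbb R^n,w_s)$, $F$ maps $H^s(\mathbb R^n,w_\alpha)$ one-to-one onto $H^\alpha(\mathbb R^n,w_s)$, and there are constants $c,C>0$ such that $$c\,\|f\,|\,H^s(\mathbb R^n,w_\alpha)\|_{\varphi_0}\le\|Ff\,|\,H^\alpha(\mathbb R^n,w_s)\|_{\psi_0}\le C\,\|f\,|\,H^s(\mathbb R^n,w_\alpha)\|_{\varphi_0}\quad\text{for all } f\in H^s(\mathbb R^n,w_\alpha).$$ In particular, $F$ maps $H^s(\mathbb R^n,w_s)$ onto itself: $F H^s(\mathbb R^n,w_s)=H^s(\mathbb R^n,w_s)$. -/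

import Mathlib

open MeasureTheory FourierTransform
open scoped SchwartzMap ENNReal

namespace WeightedSobolev

noncomputable section

/-- The polynomial weight `w_α(x) = (1 + |x|²)^(α/2)` on `ℝⁿ`. -/
def weight {n : ℕ} (α : ℝ) (x : EuclideanSpace ℝ (Fin n)) : ℝ :=
  (1 + ‖x‖ ^ 2) ^ (α / 2)

/-- Multiplication by a weight is multiplication by a smooth function of temperate growth, so
that it is defined on all tempered distributions. -/
theorem weight_hasTemperateGrowth (n : ℕ) (α : ℝ) :
    (fun x : EuclideanSpace ℝ (Fin n) => (weight α x : ℂ)).HasTemperateGrowth := by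
  unfold weight
  fun_prop

/-- `φ₀` generates a smooth dyadic resolution of unity: it is a Schwartz function with
`φ₀(x) = 1` for `|x| ≤ 1` and `φ₀(x) = 0` for `|x| ≥ 3/2`. -/
structure IsDyadicGenerator {n : ℕ} (φ₀ : 𝓢(EuclideanSpace ℝ (Fin n), ℂ)) : Prop where
  eq_one : ∀ x, ‖x‖ ≤ 1 → φ₀ x = 1
  eq_zero : ∀ x, 3 / 2 ≤ ‖x‖ → φ₀ x = 0

/-- The dyadic resolution of unity generated by `φ₀`: the functions `φ₀` and
`φ_j(x) = φ₀(2^(-j) x) - φ₀(2^(-j+1) x)` for `j ≥ 1`. -/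
def dyadic {n : ℕ} (φ₀ : 𝓢(EuclideanSpace ℝ (Fin n), ℂ)) :
    ℕ → EuclideanSpace ℝ (Fin n) → ℂ
  | 0 => fun x => φ₀ x
  | j + 1 => fun x => φ₀ (((2 : ℝ) ^ (j + 1))⁻¹ • x) - φ₀ (((2 : ℝ) ^ j)⁻¹ • x)

/-- The functions of the resolution are of temperate growth, so that the Fourier multipliers
with these symbols act on all tempered distributions. -/
theorem dyadic_hasTemperateGrowth {n : ℕ} (φ₀ : 𝓢(EuclideanSpace ℝ (Fin n), ℂ)) (j : ℕ) :
    (dyadic φ₀ j).HasTemperateGrowth := by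
  have h : ∀ c : ℝ, (fun x => φ₀ (c • x)).HasTemperateGrowth := fun c =>
    φ₀.hasTemperateGrowth.comp
      (c • ContinuousLinearMap.id ℝ (EuclideanSpace ℝ (Fin n))).hasTemperateGrowth
  cases j with
  | zero => exact φ₀.hasTemperateGrowth
  | succ j => exact (h _).sub (h _)

/-- The `L²`-norm of a tempered distribution `u` on `ℝⁿ`: the norm of the (unique) function in
`L²` that represents `u`, and `∞` if `u` is not represented by a function in `L²`. -/
def l2Norm {n : ℕ} (u : 𝓢'(EuclideanSpace ℝ (Fin n), ℂ)) : ℝ≥0∞ :=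
  ⨅ (g : Lp ℂ 2 (volume : Measure (EuclideanSpace ℝ (Fin n))))
    (_ : (g : 𝓢'(EuclideanSpace ℝ (Fin n), ℂ)) = u), ‖g‖ₑ

/-- The norm of `L²(ℝⁿ, w_α)`, that is `‖u | L²(w_α)‖ = ‖w_α u | L²‖`. -/
def weightedL2Norm {n : ℕ} (α : ℝ) (u : 𝓢'(EuclideanSpace ℝ (Fin n), ℂ)) : ℝ≥0∞ :=
  l2Norm (TemperedDistribution.smulLeftCLM ℂ (fun x => (weight α x : ℂ)) u)

/-- The norm of `H^s(ℝⁿ, w_α) = B^s_{2,2}(ℝⁿ, w_α)`, namely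
`‖f‖ = (∑_j (2^(js) ‖(φ_j f^)^∨ | L²(w_α)‖)²)^(1/2)`, with values in `[0, ∞]`. -/
def sobolevNorm {n : ℕ} (φ₀ : 𝓢(EuclideanSpace ℝ (Fin n), ℂ)) (s α : ℝ)
    (f : 𝓢'(EuclideanSpace ℝ (Fin n), ℂ)) : ℝ≥0∞ :=
  (∑' j : ℕ, (ENNReal.ofReal ((2 : ℝ) ^ ((j : ℝ) * s)) *
    weightedL2Norm α (TemperedDistribution.fourierMultiplierCLM ℂ (dyadic φ₀ j) f)) ^ 2)
      ^ (1 / 2 : ℝ)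

theorem l2Norm_zero (n : ℕ) : l2Norm (0 : 𝓢'(EuclideanSpace ℝ (Fin n), ℂ)) = 0 := by
  refine le_antisymm (iInf₂_le_of_le 0 ?_ (by simp)) bot_le
  rw [← Lp.toTemperedDistributionCLM_apply, map_zero]

theorem l2Norm_add_le {n : ℕ} (u v : 𝓢'(EuclideanSpace ℝ (Fin n), ℂ)) :
    l2Norm (u + v) ≤ l2Norm u + l2Norm v := by
  refine ENNReal.le_iInf₂_add_iInf₂ fun g hg h hh => ?_
  refine iInf₂_le_of_le (g + h) ?_ (enorm_add_le g h)
  rw [← Lp.toTemperedDistributionCLM_apply, map_add, Lp.toTemperedDistributionCLM_apply,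
    Lp.toTemperedDistributionCLM_apply, hg, hh]

theorem l2Norm_smul_le {n : ℕ} (c : ℂ) (u : 𝓢'(EuclideanSpace ℝ (Fin n), ℂ)) :
    l2Norm (c • u) ≤ ‖c‖ₑ * l2Norm u := by
  by_cases hc : c = 0
  · have h0 : (0 : ℂ) • u = 0 := by
      ext v
      exact zero_smul ℂ (u v)
    rw [hc, h0, l2Norm_zero]
    exact bot_le
  have h0 : ‖c‖ₑ ≠ 0 := by simpa using hc
  have h1 : ‖c‖ₑ ≠ ∞ := by simp
  unfold l2Norm
  rw [ENNReal.mul_iInf_of_ne h0 h1]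
  refine le_iInf fun g => ?_
  rw [ENNReal.mul_iInf_of_ne h0 h1]
  refine le_iInf fun hg => ?_
  refine iInf₂_le_of_le (c • g) ?_ (enorm_smul c g).le
  rw [← Lp.toTemperedDistributionCLM_apply, map_smul, Lp.toTemperedDistributionCLM_apply, hg]

theorem sobolevNorm_zero {n : ℕ} (φ₀ : 𝓢(EuclideanSpace ℝ (Fin n), ℂ)) (s α : ℝ) :
    sobolevNorm φ₀ s α 0 = 0 := by
  simp [sobolevNorm, weightedL2Norm, l2Norm_zero]

theorem sobolevNorm_add_le {n : ℕ} (φ₀ : 𝓢(EuclideanSpace ℝ (Fin n), ℂ)) (s α : ℝ)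
    (f g : 𝓢'(EuclideanSpace ℝ (Fin n), ℂ)) :
    sobolevNorm φ₀ s α (f + g) ≤ sobolevNorm φ₀ s α f + sobolevNorm φ₀ s α g := by
  set a : 𝓢'(EuclideanSpace ℝ (Fin n), ℂ) → ℕ → ℝ≥0∞ := fun f j =>
    ENNReal.ofReal ((2 : ℝ) ^ ((j : ℝ) * s)) *
      weightedL2Norm α (TemperedDistribution.fourierMultiplierCLM ℂ (dyadic φ₀ j) f) with ha
  have key : ∀ j, a (f + g) j ≤ a f j + a g j := fun j => by
    simp only [ha, weightedL2Norm, map_add, ← mul_add]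
    gcongr
    exact l2Norm_add_le _ _
  have h := ENNReal.lintegral_Lp_add_le (μ := (Measure.count : Measure ℕ)) (p := 2)
    (f := a f) (g := a g) (measurable_of_countable _).aemeasurable
    (measurable_of_countable _).aemeasurable (by norm_num)
  simp only [lintegral_count, ENNReal.rpow_two, Pi.add_apply] at h
  refine le_trans ?_ h
  change (∑' j, a (f + g) j ^ 2) ^ (1 / 2 : ℝ) ≤ _
  gcongr with j
  exact key j

theorem sobolevNorm_smul_le {n : ℕ} (φ₀ : 𝓢(EuclideanSpace ℝ (Fin n), ℂ)) (s α : ℝ)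
    (c : ℂ) (f : 𝓢'(EuclideanSpace ℝ (Fin n), ℂ)) :
    sobolevNorm φ₀ s α (c • f) ≤ ‖c‖ₑ * sobolevNorm φ₀ s α f := by
  have h2 : ‖c‖ₑ = (‖c‖ₑ ^ 2) ^ (1 / 2 : ℝ) := by
    rw [← ENNReal.rpow_natCast, ← ENNReal.rpow_mul]
    norm_num
  unfold sobolevNorm
  rw [h2, ← ENNReal.mul_rpow_of_nonneg _ _ (by norm_num), ← ENNReal.tsum_mul_left]
  gcongr with j
  rw [← mul_pow, mul_left_comm]
  gcongr
  simp only [weightedL2Norm, map_smul]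
  exact l2Norm_smul_le _ _

/-- The space `H^s(ℝⁿ, w_α) = B^s_{2,2}(ℝⁿ, w_α)`: the tempered distributions `f` on `ℝⁿ` with
`‖f | H^s(w_α)‖ < ∞`. -/
def sobolevSpace {n : ℕ} (φ₀ : 𝓢(EuclideanSpace ℝ (Fin n), ℂ)) (s α : ℝ) :
    Submodule ℂ 𝓢'(EuclideanSpace ℝ (Fin n), ℂ) where
  carrier := {f | sobolevNorm φ₀ s α f < ∞}
  zero_mem' := by simp [sobolevNorm_zero]
  add_mem' {f g} hf hg :=
    (sobolevNorm_add_le φ₀ s α f g).trans_lt (ENNReal.add_lt_top.2 ⟨hf, hg⟩)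
  smul_mem' c f hf :=
    (sobolevNorm_smul_le φ₀ s α c f).trans_lt (ENNReal.mul_lt_top (by simp) hf)

end

end WeightedSobolev

/-!
The Fourier transform interchanges the two localizations that enter the norm of `H^s(w_α)`: the
smooth resolution `φ_j(D)` in frequency, which carries the smoothness `s`, and the weight `w_α` in
space. By the definition of the norms, the assertion compares
`∑_j 2^(2js) ‖w_α φ_j(D) f‖²` with `∑_k 2^(2kα) ‖w_s (ψ_k f)^∧‖²`, up to reflections, that is, a
localization to a shell `j` in frequency followed by one in space with the two localizations in
the opposite order. They almost commute, and the proof makes this quantitative.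

By duality (`l2Norm_le_of_forall_enorm_le`) it suffices to test `w_s (ψ_k f)^∧` on Schwartz
functions `h`. Resolve `h = ∑_i φ_i h` and then `f = ∑_j φ_j(D) f`, and decompose the integral
against the `L²`-function `w_α φ_j(D) f` into shells `l` in space. The shells `i` and `j`
refer to frequency, `k` and `l` to space. The whole matter rests on the decay of the interaction in
`|i - j|` and `|k - l|`, which is `exists_eLpNorm_phaseLocalization_le`. It has a single source:
the operators `η(2^(-m) D)`, `m ≥ 0`, are bounded in `L²(w_N)` for every real `N`, uniformly in `m`
(`exists_weightedNorm_fourier_mul_fourierInv_le`), by Peetre's inequality for the weights and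
Young's inequality for the kernel. Applied to `χ_j(D)` with weights in space, it gives decay in
`|k - l|`; applied to the multiplication by `ψ_k` on the Fourier side, with weights in frequency, it
gives decay in `|i - j|`; the better of the two bounds decays in both distances. Schur's test on
`ℓ²(ℕ × ℕ)` then sums up the interactions (`tsum_sq_tsum_dyadicDecay_le`), and this is the
boundedness of the Fourier transform (`exists_sobolevNorm_fourier_le`), for all parameters and all
resolutions. As the inverse of the Fourier transform is its third power, the inverse is bounded
as well, and the theorem follows.
-/

namespace WeightedSobolev

noncomputable section

variable {n : ℕ}

/-! ### Schur's test and dyadic sums -/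

theorem rpow_half_sq (t : ℝ≥0∞) : (t ^ (1 / 2 : ℝ)) ^ 2 = t := by
  rw [← ENNReal.rpow_natCast, ← ENNReal.rpow_mul]
  norm_num

/-- The Cauchy–Schwarz inequality for the measure with density `K`. -/
theorem lintegral_mul_sq_le {β : Type*} [MeasurableSpace β] {ν : Measure β} {K a : β → ℝ≥0∞}
    (hK : AEMeasurable K ν) (ha : AEMeasurable a ν) :
    (∫⁻ y, K y * a y ∂ν) ^ 2 ≤ (∫⁻ y, K y ∂ν) * ∫⁻ y, K y * a y ^ 2 ∂ν := by
  have h := ENNReal.lintegral_mul_le_Lp_mul_Lq ν (p := 2) (q := 2) (by constructor <;> norm_num)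
    (hK.pow_const (1 / 2 : ℝ)) ((hK.pow_const (1 / 2 : ℝ)).mul ha)
  simp only [Pi.mul_apply, ENNReal.rpow_two, mul_pow, rpow_half_sq, ← mul_assoc, ← sq] at h
  calc _ ≤ _ := pow_le_pow_left' h 2
    _ = _ := by rw [mul_pow, rpow_half_sq, rpow_half_sq]

/-- Schur's test in `L²` for a nonnegative kernel. -/
theorem lintegral_sq_lintegral_mul_le {α β : Type*} [MeasurableSpace α] [MeasurableSpace β]
    {μ : Measure α} {ν : Measure β} [SFinite μ] [SFinite ν] {K : α → β → ℝ≥0∞} {a : β → ℝ≥0∞}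
    (hK : Measurable (Function.uncurry K)) (ha : Measurable a) {A B : ℝ≥0∞}
    (hA : ∀ x, ∫⁻ y, K x y ∂ν ≤ A) (hB : ∀ y, ∫⁻ x, K x y ∂μ ≤ B) :
    ∫⁻ x, (∫⁻ y, K x y * a y ∂ν) ^ 2 ∂μ ≤ A * B * ∫⁻ y, a y ^ 2 ∂ν := by
  calc _ ≤ ∫⁻ x, A * ∫⁻ y, K x y * a y ^ 2 ∂ν ∂μ := by
        refine lintegral_mono fun x => ?_
        refine (lintegral_mul_sq_le (hK.of_uncurry_left).aemeasurable ha.aemeasurable).trans ?_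
        gcongr
        exact hA x
    _ = A * ∫⁻ y, ∫⁻ x, K x y * a y ^ 2 ∂μ ∂ν := by
        have hm : Measurable (Function.uncurry fun x y => K x y * a y ^ 2) :=
          hK.mul ((ha.comp measurable_snd).pow_const 2)
        have hm' : Measurable fun x => ∫⁻ y, K x y * a y ^ 2 ∂ν := hm.lintegral_prod_right'
        rw [lintegral_const_mul _ hm', lintegral_lintegral_swap hm.aemeasurable]
    _ ≤ A * ∫⁻ y, B * a y ^ 2 ∂ν := by
        gcongr with y
        rw [lintegral_mul_const _ (hK.of_uncurry_right)]
        gcongr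
        exact hB y
    _ = _ := by rw [lintegral_const_mul _ (ha.pow_const 2), mul_assoc]

/-- The kernel `2^(-|i - j|)`, which measures the interaction of two dyadic shells. -/
def dyadicDecay (i j : ℕ) : ℝ≥0∞ := ENNReal.ofReal (2 ^ (-|(i : ℝ) - j|))

theorem dyadicDecay_comm (i j : ℕ) : dyadicDecay i j = dyadicDecay j i := by
  rw [dyadicDecay, dyadicDecay, abs_sub_comm]

theorem tsum_dyadicDecay_le (i : ℕ) : ∑' j, dyadicDecay i j ≤ 3 := by
  have h0 : ∀ j : ℕ, dyadicDecay 0 j = 2⁻¹ ^ j := fun j => by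
    rw [dyadicDecay, Nat.cast_zero, zero_sub, abs_neg, Nat.abs_cast, Real.rpow_neg (by norm_num),
      Real.rpow_natCast, ← inv_pow, ENNReal.ofReal_pow (by norm_num),
      ENNReal.ofReal_inv_of_pos (by norm_num)]
    simp
  -- Moving `i` by one changes only the contribution of the left end of the sequence.
  have key : ∑' j, dyadicDecay i j + dyadicDecay 0 i = 3 := by
    induction i with
    | zero =>
      simp only [h0, ENNReal.tsum_geometric, ENNReal.one_sub_inv_two, inv_inv, pow_zero]
      norm_num
    | succ i ih =>
      have hs : ∀ j, dyadicDecay (i + 1) (j + 1) = dyadicDecay i j := fun j => by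
        simp only [dyadicDecay, Nat.cast_add, add_sub_add_right_eq_sub]
      have hd : dyadicDecay 0 (i + 1) + dyadicDecay 0 (i + 1) = dyadicDecay 0 i := by
        simp only [h0, pow_succ, ← mul_add, ENNReal.inv_two_add_inv_two, mul_one]
      rw [tsum_eq_zero_add' ENNReal.summable, dyadicDecay_comm (i + 1) 0]
      simp only [hs]
      rw [add_right_comm, hd, add_comm, ih]
  exact key ▸ le_self_add

/-- The convolution with `2^(-|i|-|k|)` is bounded in `ℓ²(ℕ × ℕ)`. -/
theorem tsum_sq_tsum_dyadicDecay_le (a : ℕ → ℕ → ℝ≥0∞) :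
    ∑' k, ∑' i, (∑' j, ∑' l, dyadicDecay i j * dyadicDecay k l * a j l) ^ 2
      ≤ 81 * ∑' j, ∑' l, a j l ^ 2 := by
  have hK : ∀ x : ℕ × ℕ, ∑' y : ℕ × ℕ, dyadicDecay x.2 y.1 * dyadicDecay x.1 y.2 ≤ 9 := fun x => by
    rw [ENNReal.tsum_prod']
    simp only [ENNReal.tsum_mul_left, ENNReal.tsum_mul_right]
    calc _ ≤ (3 : ℝ≥0∞) * 3 := mul_le_mul' (tsum_dyadicDecay_le _) (tsum_dyadicDecay_le _)
      _ = 9 := by norm_num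
  have h := lintegral_sq_lintegral_mul_le (μ := (Measure.count : Measure (ℕ × ℕ)))
    (ν := (Measure.count : Measure (ℕ × ℕ)))
    (K := fun x y => dyadicDecay x.2 y.1 * dyadicDecay x.1 y.2) (a := fun y => a y.1 y.2)
    (A := 9) (B := 9) (measurable_of_countable _) (measurable_of_countable _)
    (fun x => by rw [lintegral_count]; exact hK x)
    (fun y => by
      rw [lintegral_count]
      refine le_trans (le_of_eq ?_) (hK (y.2, y.1).swap.swap)
      rw [← (Equiv.prodComm ℕ ℕ).tsum_eq]
      refine tsum_congr fun x => ?_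
      simp only [Equiv.prodComm_apply, Prod.fst_swap, Prod.snd_swap]
      rw [dyadicDecay_comm x.1 y.1, dyadicDecay_comm x.2 y.2, mul_comm])
  simp only [lintegral_count, ENNReal.tsum_prod'] at h
  norm_num at h
  exact h

/-- The Cauchy–Schwarz inequality for series. -/
theorem tsum_mul_le_sqrt_mul_sqrt (a b : ℕ → ℝ≥0∞) :
    ∑' i, a i * b i ≤ (∑' i, a i ^ 2) ^ (1 / 2 : ℝ) * (∑' i, b i ^ 2) ^ (1 / 2 : ℝ) := by
  have h := ENNReal.lintegral_mul_le_Lp_mul_Lq (Measure.count : Measure ℕ) (p := 2) (q := 2)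
    (f := a) (g := b) (by constructor <;> norm_num)
    (measurable_of_countable _).aemeasurable (measurable_of_countable _).aemeasurable
  simpa only [lintegral_count, Pi.mul_apply, ENNReal.rpow_two] using h

theorem enorm_le_tsum_of_tendsto {G : Type*} [NormedAddCommGroup G] {u : ℕ → G} {a : G}
    (h : Filter.Tendsto (fun m => ∑ j ∈ Finset.range m, u j) Filter.atTop (nhds a)) :
    ‖a‖ₑ ≤ ∑' j, ‖u j‖ₑ :=
  le_of_tendsto h.enorm <| Filter.Eventually.of_forall fun m =>
    (enorm_sum_le (Finset.range m) u).trans (ENNReal.sum_le_tsum (Finset.range m))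

/-! ### Duality for the `L²`-norm of a tempered distribution -/

theorem enorm_toLp_eq (h : 𝓢(EuclideanSpace ℝ (Fin n), ℂ)) :
    ‖h.toLp 2 volume‖ₑ = eLpNorm h 2 volume := by
  rw [Lp.enorm_def, eLpNorm_congr_ae (h.coeFn_toLp 2 volume)]

/-- A tempered distribution that is bounded in the `L²`-norm on Schwartz functions is represented
by a function in `L²`, by the Riesz representation theorem and the density of the Schwartz
functions in `L²`. -/
theorem l2Norm_le_of_forall_enorm_le {v : 𝓢'(EuclideanSpace ℝ (Fin n), ℂ)} {M : ℝ≥0∞}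
    (hv : ∀ h : 𝓢(EuclideanSpace ℝ (Fin n), ℂ), ‖v h‖ₑ ≤ M * eLpNorm h 2 volume) :
    l2Norm v ≤ M := by
  rcases eq_or_ne M ∞ with rfl | hM
  · exact le_top
  set e : 𝓢(EuclideanSpace ℝ (Fin n), ℂ) →ₗ[ℂ] Lp ℂ 2 (volume : Measure (EuclideanSpace ℝ (Fin n)))
    := (SchwartzMap.toLpCLM ℂ ℂ 2 volume).toLinearMap with he
  set f : 𝓢(EuclideanSpace ℝ (Fin n), ℂ) →ₗ[ℂ] ℂ := v.toLinearMap with hf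
  have hdense : DenseRange e := SchwartzMap.denseRange_toLpCLM (by norm_num)
  have hnorm : ∀ h, ‖f h‖ ≤ M.toReal * ‖e h‖ := fun h => by
    have h1 := hv h
    rw [← enorm_toLp_eq, ← ENNReal.ofReal_toReal hM, ← ofReal_norm, ← ofReal_norm,
      ← ENNReal.ofReal_mul ENNReal.toReal_nonneg,
      ENNReal.ofReal_le_ofReal_iff (by positivity)] at h1
    exact h1
  set g := (InnerProductSpace.toDual ℂ _).symm (f.extendOfNorm e) with hg
  have hgn : ‖g‖ ≤ M.toReal := by
    rw [hg, LinearIsometryEquiv.norm_map]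
    exact LinearMap.opNorm_extendOfNorm_le hdense ENNReal.toReal_nonneg hnorm
  refine iInf₂_le_of_le (star g) ?_ ?_
  · ext h
    have h1 : inner ℂ g (e h) = v h := by
      rw [hg, InnerProductSpace.toDual_symm_apply, LinearMap.extendOfNorm_eq hdense ⟨_, hnorm⟩]
      rfl
    rw [← h1, Lp.toTemperedDistribution_apply, L2.inner_def]
    refine integral_congr_ae ?_
    filter_upwards [Lp.coeFn_star g, h.coeFn_toLp 2 volume] with x hx hx'
    have : (e h) x = h x := hx'
    rw [hx, this]
    simp
  · have hstar : ‖star g‖ₑ = ‖g‖ₑ := by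
      rw [Lp.enorm_def, Lp.enorm_def]
      refine eLpNorm_congr_norm_ae ?_
      filter_upwards [Lp.coeFn_star g] with x hx
      rw [hx, Pi.star_apply, norm_star]
    rw [hstar, ← ofReal_norm, ← ENNReal.ofReal_toReal hM]
    exact ENNReal.ofReal_le_ofReal hgn

theorem exists_lp_enorm_le_l2Norm {v : 𝓢'(EuclideanSpace ℝ (Fin n), ℂ)} (hv : l2Norm v ≠ ∞) :
    ∃ g : Lp ℂ 2 (volume : Measure (EuclideanSpace ℝ (Fin n))),
      (g : 𝓢'(EuclideanSpace ℝ (Fin n), ℂ)) = v ∧ ‖g‖ₑ ≤ l2Norm v := by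
  have hex : ∃ g : Lp ℂ 2 (volume : Measure (EuclideanSpace ℝ (Fin n))),
      (g : 𝓢'(EuclideanSpace ℝ (Fin n), ℂ)) = v := by
    by_contra! hne
    exact hv (by simp [l2Norm, hne])
  obtain ⟨g, hg⟩ := hex
  refine ⟨g, hg, le_iInf₂ fun g' hg' => le_of_eq ?_⟩
  -- The embedding of `L²` into the tempered distributions is injective.
  have hinj := LinearMap.ker_eq_bot.1 (Lp.ker_toTemperedDistributionCLM_eq_bot (F := ℂ)
    (μ := (volume : Measure (EuclideanSpace ℝ (Fin n)))) (p := 2))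
  rw [hinj (hg'.trans hg.symm : Lp.toTemperedDistributionCLM ℂ volume 2 g'
    = Lp.toTemperedDistributionCLM ℂ volume 2 g)]

/-! ### Weights and dyadic shells -/

theorem weight_pos (N : ℝ) (x : EuclideanSpace ℝ (Fin n)) : 0 < weight N x := by
  unfold weight; positivity

theorem continuous_weight (N : ℝ) :
    Continuous (weight N : EuclideanSpace ℝ (Fin n) → ℝ) := by
  unfold weight
  exact Continuous.rpow_const (by fun_prop) fun x => Or.inl (by positivity)

theorem weight_add (N M : ℝ) (x : EuclideanSpace ℝ (Fin n)) :
    weight (N + M) x = weight N x * weight M x := by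
  rw [weight, weight, weight, ← Real.rpow_add (by positivity)]
  ring_nf

theorem weight_zero (x : EuclideanSpace ℝ (Fin n)) : weight 0 x = 1 := by simp [weight]

theorem weight_mul_weight_neg (N : ℝ) (x : EuclideanSpace ℝ (Fin n)) :
    weight N x * weight (-N) x = 1 := by
  rw [← weight_add, add_neg_cancel, weight_zero]

theorem weight_eq_rpow (N : ℝ) (x : EuclideanSpace ℝ (Fin n)) :
    weight N x = weight 1 x ^ N := by
  rw [weight, weight, ← Real.rpow_mul (by positivity)]
  ring_nf

theorem weight_one_eq_sqrt (x : EuclideanSpace ℝ (Fin n)) :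
    weight 1 x = √(1 + ‖x‖ ^ 2) := by
  rw [weight, Real.sqrt_eq_rpow]

theorem one_le_weight_one (x : EuclideanSpace ℝ (Fin n)) : 1 ≤ weight 1 x := by
  rw [weight_one_eq_sqrt]
  exact Real.one_le_sqrt.2 (by nlinarith [sq_nonneg ‖x‖])

theorem norm_le_weight_one (x : EuclideanSpace ℝ (Fin n)) : ‖x‖ ≤ weight 1 x := by
  rw [weight_one_eq_sqrt]
  exact Real.le_sqrt_of_sq_le (by linarith)

theorem weight_one_le_one_add_norm (x : EuclideanSpace ℝ (Fin n)) : weight 1 x ≤ 1 + ‖x‖ := by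
  rw [weight_one_eq_sqrt, Real.sqrt_le_left (by positivity)]
  nlinarith [norm_nonneg x]

theorem weight_one_add_le (x y : EuclideanSpace ℝ (Fin n)) :
    weight 1 (x + y) ≤ 2 * (weight 1 x * weight 1 y) := by
  have hsq : ∀ z : EuclideanSpace ℝ (Fin n), weight 1 z ^ 2 = 1 + ‖z‖ ^ 2 := fun z => by
    rw [weight_one_eq_sqrt, Real.sq_sqrt (by positivity)]
  have hx := weight_pos 1 x
  have hy := weight_pos 1 y
  refine (pow_le_pow_iff_left₀ (weight_pos 1 _).le (by positivity) two_ne_zero).1 ?_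
  rw [mul_pow, mul_pow, hsq, hsq, hsq]
  nlinarith [norm_add_le x y, norm_nonneg (x + y), sq_nonneg (‖x‖ - ‖y‖), sq_nonneg (‖x‖ * ‖y‖),
    pow_le_pow_left₀ (norm_nonneg (x + y)) (norm_add_le x y) 2]

/-- Peetre's inequality. -/
theorem weight_le_mul_weight_sub (N : ℝ) (x y : EuclideanSpace ℝ (Fin n)) :
    weight N x ≤ 2 ^ |N| * (weight |N| (x - y) * weight N y) := by
  have hx := weight_pos 1 x
  have hy := weight_pos 1 y
  have hz := weight_pos 1 (x - y)
  have hneg : weight 1 (y - x) = weight 1 (x - y) := by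
    rw [weight_one_eq_sqrt, weight_one_eq_sqrt, norm_sub_rev]
  rw [weight_eq_rpow N x, weight_eq_rpow |N|, weight_eq_rpow N y]
  rcases le_total 0 N with hN | hN
  · rw [abs_of_nonneg hN, ← Real.mul_rpow hz.le hy.le, ← Real.mul_rpow (by norm_num) (by positivity)]
    refine Real.rpow_le_rpow hx.le ?_ hN
    simpa using weight_one_add_le (x - y) y
  · rw [abs_of_nonpos hN]
    have h : weight 1 y ^ (-N) ≤ 2 ^ (-N) * (weight 1 (x - y) ^ (-N) * weight 1 x ^ (-N)) := by
      rw [← Real.mul_rpow hz.le hx.le, ← Real.mul_rpow (by norm_num) (by positivity)]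
      refine Real.rpow_le_rpow hy.le ?_ (by linarith)
      rw [← hneg]
      simpa using weight_one_add_le (y - x) x
    have e1 : weight 1 y ^ (-N) * weight 1 y ^ N = 1 := by
      rw [← Real.rpow_add hy, neg_add_cancel, Real.rpow_zero]
    have e2 : weight 1 x ^ (-N) * weight 1 x ^ N = 1 := by
      rw [← Real.rpow_add hx, neg_add_cancel, Real.rpow_zero]
    calc weight 1 x ^ N = weight 1 y ^ (-N) * (weight 1 y ^ N * weight 1 x ^ N) := by
          rw [← mul_assoc, e1, one_mul]
      _ ≤ 2 ^ (-N) * (weight 1 (x - y) ^ (-N) * weight 1 x ^ (-N))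
            * (weight 1 y ^ N * weight 1 x ^ N) := by gcongr
      _ = 2 ^ (-N) * (weight 1 (x - y) ^ (-N) * weight 1 y ^ N)
            * (weight 1 x ^ (-N) * weight 1 x ^ N) := by ring
      _ = _ := by rw [e2, mul_one]

/-- The index of the dyadic shell `2^l ≤ (1 + |x|²)^(1/2) < 2^(l+1)` that contains `x`. -/
def shellIndex (x : EuclideanSpace ℝ (Fin n)) : ℕ := Nat.log 2 ⌊weight 1 x⌋₊

theorem measurable_shellIndex :
    Measurable (shellIndex : EuclideanSpace ℝ (Fin n) → ℕ) :=
  (measurable_of_countable (Nat.log 2)).comp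
    (Nat.measurable_floor.comp (continuous_weight 1).measurable)

theorem two_pow_shellIndex_le (x : EuclideanSpace ℝ (Fin n)) :
    (2 : ℝ) ^ shellIndex x ≤ weight 1 x := by
  have h : ⌊weight 1 x⌋₊ ≠ 0 := (Nat.floor_pos.2 (one_le_weight_one x)).ne'
  calc (2 : ℝ) ^ shellIndex x = ((2 ^ Nat.log 2 ⌊weight 1 x⌋₊ : ℕ) : ℝ) := by simp [shellIndex]
    _ ≤ (⌊weight 1 x⌋₊ : ℝ) := by exact_mod_cast Nat.pow_log_le_self 2 h
    _ ≤ _ := Nat.floor_le (weight_pos 1 x).le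

theorem weight_one_lt_two_pow_shellIndex (x : EuclideanSpace ℝ (Fin n)) :
    weight 1 x < 2 * 2 ^ shellIndex x := by
  have h : ⌊weight 1 x⌋₊ < 2 ^ (Nat.log 2 ⌊weight 1 x⌋₊ + 1) :=
    Nat.lt_pow_succ_log_self (by norm_num) _
  have h' := Nat.lt_of_floor_lt h
  rw [pow_succ'] at h'
  simpa [shellIndex] using h'

/-- The shell `2^j ≲ |x| ≲ 2^j` (a ball for small `j`), enlarged so as to contain the supports of
the functions `φ_j` and of their fattened versions. -/
def fatShell (j : ℕ) : Set (EuclideanSpace ℝ (Fin n)) :=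
  {x | 2 ^ j ≤ 4 * weight 1 x ∧ weight 1 x ≤ 4 * 2 ^ j}

theorem mem_fatShell_shellIndex (x : EuclideanSpace ℝ (Fin n)) : x ∈ fatShell (shellIndex x) := by
  have h1 := two_pow_shellIndex_le x
  have h2 := weight_one_lt_two_pow_shellIndex x
  have h3 := weight_pos 1 x
  constructor <;> linarith

theorem weight_le_of_mem_fatShell (N : ℝ) {j : ℕ} {x : EuclideanSpace ℝ (Fin n)}
    (hx : x ∈ fatShell j) : weight N x ≤ 4 ^ |N| * 2 ^ (N * j) := by
  obtain ⟨h1, h2⟩ := hx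
  have hp := weight_pos 1 x
  have hj : (2 : ℝ) ^ (N * j) = (2 ^ j) ^ N := by
    rw [mul_comm, Real.rpow_mul (by norm_num), Real.rpow_natCast]
  rw [weight_eq_rpow, hj]
  rcases le_total 0 N with hN | hN
  · rw [abs_of_nonneg hN, ← Real.mul_rpow (by norm_num) (by positivity)]
    exact Real.rpow_le_rpow hp.le h2 hN
  · rw [abs_of_nonpos hN, Real.rpow_neg (by norm_num), ← Real.inv_rpow (by norm_num),
      ← Real.mul_rpow (by norm_num) (by positivity)]
    exact Real.rpow_le_rpow_of_nonpos (by positivity) (by linarith) hN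

theorem one_le_of_mem_fatShell (N : ℝ) {j : ℕ} {x : EuclideanSpace ℝ (Fin n)}
    (hx : x ∈ fatShell j) : 1 ≤ 4 ^ |N| * 2 ^ (-(N * j)) * weight N x := by
  have h := weight_le_of_mem_fatShell (-N) hx
  rw [abs_neg, neg_mul] at h
  calc 1 = weight (-N) x * weight N x := by rw [mul_comm, weight_mul_weight_neg]
    _ ≤ _ := by gcongr; exact (weight_pos N x).le

/-- In particular, a point lies in boundedly many of the enlarged shells. -/
theorem abs_sub_shellIndex_le_of_mem_fatShell {i : ℕ} {x : EuclideanSpace ℝ (Fin n)}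
    (hx : x ∈ fatShell i) : |(shellIndex x : ℝ) - i| ≤ 3 := by
  obtain ⟨h1, h2⟩ := hx
  have h3 := two_pow_shellIndex_le x
  have h4 := weight_one_lt_two_pow_shellIndex x
  have h5 : (2 : ℝ) ^ i < 2 ^ (shellIndex x + 3) := by rw [pow_add]; linarith
  have h6 : (2 : ℝ) ^ shellIndex x ≤ 2 ^ (i + 2) := by rw [pow_add]; linarith
  have h7 := (pow_lt_pow_iff_right₀ (by norm_num : (1 : ℝ) < 2)).1 h5
  have h8 := (pow_le_pow_iff_right₀ (by norm_num : (1 : ℝ) < 2)).1 h6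
  have h9 : (i : ℝ) < shellIndex x + 3 := by exact_mod_cast h7
  have h10 : (shellIndex x : ℝ) ≤ i + 2 := by exact_mod_cast h8
  rw [abs_le]
  constructor <;> linarith

/-! ### Dyadic resolutions -/

/-- The dilation `x ↦ φ₀(2^(-m) x)`. -/
def dilate (φ₀ : 𝓢(EuclideanSpace ℝ (Fin n), ℂ)) (m : ℕ) (x : EuclideanSpace ℝ (Fin n)) : ℂ :=
  φ₀ (((2 : ℝ) ^ m)⁻¹ • x)

/-- A fattened version of the dyadic resolution: it is equal to `1` on the support of `φ_j`. -/
def fatDyadic (φ₀ : 𝓢(EuclideanSpace ℝ (Fin n), ℂ)) : ℕ → EuclideanSpace ℝ (Fin n) → ℂ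
  | 0 => dilate φ₀ 1
  | 1 => dilate φ₀ 2
  | j + 2 => dilate φ₀ (j + 3) - dilate φ₀ j

theorem dilate_hasTemperateGrowth (φ₀ : 𝓢(EuclideanSpace ℝ (Fin n), ℂ)) (m : ℕ) :
    (dilate φ₀ m).HasTemperateGrowth :=
  φ₀.hasTemperateGrowth.comp
    (((2 : ℝ) ^ m)⁻¹ • ContinuousLinearMap.id ℝ (EuclideanSpace ℝ (Fin n))).hasTemperateGrowth

/-- The functions `φ_j` and their fattened versions are dilations of `φ₀` or differences of two of
them, so uniform estimates for them reduce to dilations. -/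
def IsDilationDifference (φ₀ : 𝓢(EuclideanSpace ℝ (Fin n), ℂ))
    (η : EuclideanSpace ℝ (Fin n) → ℂ) : Prop :=
  (∃ m, η = dilate φ₀ m) ∨ ∃ m m', η = dilate φ₀ m - dilate φ₀ m'

theorem isDilationDifference_dyadic (φ₀ : 𝓢(EuclideanSpace ℝ (Fin n), ℂ)) (j : ℕ) :
    IsDilationDifference φ₀ (dyadic φ₀ j) := by
  cases j with
  | zero => exact Or.inl ⟨0, by ext x; simp [dyadic, dilate]⟩
  | succ j => exact Or.inr ⟨j + 1, j, rfl⟩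

theorem isDilationDifference_fatDyadic (φ₀ : 𝓢(EuclideanSpace ℝ (Fin n), ℂ)) (j : ℕ) :
    IsDilationDifference φ₀ (fatDyadic φ₀ j) := by
  match j with
  | 0 => exact Or.inl ⟨1, rfl⟩
  | 1 => exact Or.inl ⟨2, rfl⟩
  | j + 2 => exact Or.inr ⟨j + 3, j, rfl⟩

theorem IsDilationDifference.hasTemperateGrowth {φ₀ : 𝓢(EuclideanSpace ℝ (Fin n), ℂ)}
    {η : EuclideanSpace ℝ (Fin n) → ℂ} (hη : IsDilationDifference φ₀ η) :
    η.HasTemperateGrowth := by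
  rcases hη with ⟨m, rfl⟩ | ⟨m, m', rfl⟩
  · exact dilate_hasTemperateGrowth φ₀ m
  · exact (dilate_hasTemperateGrowth φ₀ m).sub (dilate_hasTemperateGrowth φ₀ m')

theorem exists_norm_le_of_isDilationDifference (φ₀ : 𝓢(EuclideanSpace ℝ (Fin n), ℂ)) :
    ∃ C : ℝ, 0 ≤ C ∧ ∀ η, IsDilationDifference φ₀ η → ∀ x, ‖η x‖ ≤ C := by
  set B := SchwartzMap.seminorm ℝ 0 0 φ₀
  have hB : ∀ x, ‖φ₀ x‖ ≤ B := SchwartzMap.norm_le_seminorm ℝ φ₀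
  have hB0 : 0 ≤ B := apply_nonneg _ _
  refine ⟨B + B, by positivity, fun η hη x => ?_⟩
  rcases hη with ⟨m, rfl⟩ | ⟨m, m', rfl⟩
  · exact (hB _).trans (by linarith)
  · exact (norm_sub_le _ _).trans (add_le_add (hB _) (hB _))

theorem dilate_eq_one {φ₀ : 𝓢(EuclideanSpace ℝ (Fin n), ℂ)} (hφ : IsDyadicGenerator φ₀) {m : ℕ}
    {x : EuclideanSpace ℝ (Fin n)} (hx : ‖x‖ ≤ 2 ^ m) : dilate φ₀ m x = 1 := by
  refine hφ.eq_one _ ?_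
  rw [norm_smul, norm_inv, norm_pow, Real.norm_ofNat, inv_mul_le_iff₀ (by positivity), mul_one]
  exact hx

theorem dilate_eq_zero {φ₀ : 𝓢(EuclideanSpace ℝ (Fin n), ℂ)} (hφ : IsDyadicGenerator φ₀) {m : ℕ}
    {x : EuclideanSpace ℝ (Fin n)} (hx : 3 / 2 * 2 ^ m ≤ ‖x‖) : dilate φ₀ m x = 0 := by
  refine hφ.eq_zero _ ?_
  rw [norm_smul, norm_inv, norm_pow, Real.norm_ofNat, inv_mul_eq_div, le_div_iff₀ (by positivity)]
  exact hx

theorem mem_fatShell_of_norm {j : ℕ} {x : EuclideanSpace ℝ (Fin n)} (h1 : 2 ^ j ≤ 4 * weight 1 x)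
    (h2 : ‖x‖ ≤ 3 * 2 ^ j) : x ∈ fatShell j := by
  refine ⟨h1, (weight_one_le_one_add_norm x).trans ?_⟩
  have : (1 : ℝ) ≤ 2 ^ j := one_le_pow₀ (by norm_num)
  linarith

theorem mem_fatShell_of_dyadic_ne_zero {φ₀ : 𝓢(EuclideanSpace ℝ (Fin n), ℂ)}
    (hφ : IsDyadicGenerator φ₀) {j : ℕ} {x : EuclideanSpace ℝ (Fin n)} (hx : dyadic φ₀ j x ≠ 0) :
    x ∈ fatShell j := by
  have hw := one_le_weight_one x
  cases j with
  | zero =>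
    refine mem_fatShell_of_norm (by simp; linarith) ?_
    by_contra! h
    exact hx (hφ.eq_zero x (by simp at h; linarith))
  | succ j =>
    have hp : (0 : ℝ) < 2 ^ j := by positivity
    have hx' : dilate φ₀ (j + 1) x - dilate φ₀ j x ≠ 0 := hx
    refine mem_fatShell_of_norm ?_ ?_
    · by_contra! h
      have := norm_le_weight_one x
      rw [pow_succ] at h
      exact hx' (by rw [dilate_eq_one hφ (by rw [pow_succ]; linarith),
        dilate_eq_one hφ (by linarith), sub_self])
    · by_contra! h
      rw [pow_succ] at h
      exact hx' (by rw [dilate_eq_zero hφ (by rw [pow_succ]; linarith),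
        dilate_eq_zero hφ (by linarith), sub_self])

theorem mem_fatShell_of_fatDyadic_ne_zero {φ₀ : 𝓢(EuclideanSpace ℝ (Fin n), ℂ)}
    (hφ : IsDyadicGenerator φ₀) {j : ℕ} {x : EuclideanSpace ℝ (Fin n)}
    (hx : fatDyadic φ₀ j x ≠ 0) : x ∈ fatShell j := by
  have hw := one_le_weight_one x
  match j with
  | 0 =>
    refine mem_fatShell_of_norm (by simp; linarith) ?_
    by_contra! h
    exact hx (dilate_eq_zero hφ (by norm_num at h ⊢; linarith))
  | 1 =>
    refine mem_fatShell_of_norm (by norm_num; linarith) ?_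
    by_contra! h
    exact hx (dilate_eq_zero hφ (by norm_num at h ⊢; linarith))
  | j + 2 =>
    have hp : (0 : ℝ) < 2 ^ j := by positivity
    have hx' : dilate φ₀ (j + 3) x - dilate φ₀ j x ≠ 0 := hx
    refine mem_fatShell_of_norm ?_ ?_
    · by_contra! h
      have := norm_le_weight_one x
      rw [pow_add] at h
      exact hx' (by rw [dilate_eq_one hφ (by rw [pow_add]; linarith),
        dilate_eq_one hφ (by linarith), sub_self])
    · by_contra! h
      rw [pow_add] at h
      exact hx' (by rw [dilate_eq_zero hφ (by rw [pow_add]; linarith),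
        dilate_eq_zero hφ (by linarith), sub_self])

theorem fatDyadic_mul_dyadic {φ₀ : 𝓢(EuclideanSpace ℝ (Fin n), ℂ)}
    (hφ : IsDyadicGenerator φ₀) (j : ℕ) : fatDyadic φ₀ j * dyadic φ₀ j = dyadic φ₀ j := by
  ext x
  rw [Pi.mul_apply]
  by_cases hx : dyadic φ₀ j x = 0
  · rw [hx, mul_zero]
  suffices h : fatDyadic φ₀ j x = 1 by rw [h, one_mul]
  match j with
  | 0 =>
    refine dilate_eq_one hφ ?_
    by_contra! h
    exact hx (hφ.eq_zero x (by norm_num at h; linarith))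
  | 1 =>
    refine dilate_eq_one hφ ?_
    by_contra! h
    have hx' : dilate φ₀ 1 x - dilate φ₀ 0 x ≠ 0 := hx
    norm_num at h
    exact hx' (by rw [dilate_eq_zero hφ (by norm_num; linarith),
        dilate_eq_zero hφ (by norm_num; linarith), sub_self])
  | j + 2 =>
    have hp : (0 : ℝ) < 2 ^ j := by positivity
    have hx' : dilate φ₀ (j + 2) x - dilate φ₀ (j + 1) x ≠ 0 := hx
    have h1 : ‖x‖ ≤ 2 ^ (j + 3) := by
      by_contra! h
      rw [pow_add] at h
      exact hx' (by rw [dilate_eq_zero hφ (by rw [pow_add]; linarith),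
        dilate_eq_zero hφ (by rw [pow_add]; linarith), sub_self])
    have h2 : 3 / 2 * 2 ^ j ≤ ‖x‖ := by
      by_contra! h
      exact hx' (by rw [dilate_eq_one hφ (by rw [pow_add]; linarith),
        dilate_eq_one hφ (by rw [pow_add]; linarith), sub_self])
    change dilate φ₀ (j + 3) x - dilate φ₀ j x = 1
    rw [dilate_eq_one hφ h1, dilate_eq_zero hφ h2, sub_zero]

theorem sum_dyadic (φ₀ : 𝓢(EuclideanSpace ℝ (Fin n), ℂ)) (m : ℕ)
    (x : EuclideanSpace ℝ (Fin n)) :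
    ∑ j ∈ Finset.range (m + 1), dyadic φ₀ j x = dilate φ₀ m x := by
  induction m with
  | zero => simp [dyadic, dilate]
  | succ m ih =>
    rw [Finset.sum_range_succ, ih]
    simp [dyadic, dilate]

/-! ### Weighted estimates for smooth Fourier multipliers -/

theorem eLpNorm_two_sq {β F : Type*} [MeasurableSpace β] [NormedAddCommGroup F] (f : β → F)
    (μ : Measure β) : eLpNorm f 2 μ ^ 2 = ∫⁻ x, ‖f x‖ₑ ^ 2 ∂μ := by
  rw [eLpNorm_eq_lintegral_rpow_enorm_toReal two_ne_zero ENNReal.ofNat_ne_top,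
    ← ENNReal.rpow_natCast, ← ENNReal.rpow_mul]
  simp

/-- The norm of a Schwartz function in `L²(ℝⁿ, w_N)`. -/
def weightedNorm (N : ℝ) (u : 𝓢(EuclideanSpace ℝ (Fin n), ℂ)) : ℝ≥0∞ :=
  eLpNorm (fun x => (weight N x : ℂ) * u x) 2 volume

theorem weightedNorm_zero (u : 𝓢(EuclideanSpace ℝ (Fin n), ℂ)) :
    weightedNorm 0 u = eLpNorm u 2 volume := by
  simp [weightedNorm, weight_zero]

theorem aestronglyMeasurable_weight_mul (N : ℝ) (u : 𝓢(EuclideanSpace ℝ (Fin n), ℂ))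
    (μ : Measure (EuclideanSpace ℝ (Fin n))) :
    AEStronglyMeasurable (fun x => (weight N x : ℂ) * u x) μ :=
  ((Complex.continuous_ofReal.comp (continuous_weight N)).mul u.continuous).aestronglyMeasurable

theorem norm_weight_mul (N : ℝ) (u : 𝓢(EuclideanSpace ℝ (Fin n), ℂ))
    (x : EuclideanSpace ℝ (Fin n)) : ‖(weight N x : ℂ) * u x‖ = weight N x * ‖u x‖ := by
  rw [norm_mul, Complex.norm_of_nonneg (weight_pos N x).le]

theorem weightedNorm_smulLeftCLM_le {η : EuclideanSpace ℝ (Fin n) → ℂ} (hη : η.HasTemperateGrowth)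
    {N M C : ℝ} (h : ∀ x, weight N x * ‖η x‖ ≤ C * weight M x)
    (u : 𝓢(EuclideanSpace ℝ (Fin n), ℂ)) :
    weightedNorm N (SchwartzMap.smulLeftCLM ℂ η u) ≤ ENNReal.ofReal C * weightedNorm M u := by
  refine eLpNorm_le_mul_eLpNorm_of_ae_le_mul (Filter.Eventually.of_forall fun x => ?_) 2
  rw [norm_weight_mul, norm_weight_mul, SchwartzMap.smulLeftCLM_apply_apply hη, norm_smul,
    ← mul_assoc, ← mul_assoc]
  exact mul_le_mul_of_nonneg_right (h x) (norm_nonneg _)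

theorem eLpNorm_fourier (u : 𝓢(EuclideanSpace ℝ (Fin n), ℂ)) :
    eLpNorm (𝓕 u : 𝓢(EuclideanSpace ℝ (Fin n), ℂ)) 2 volume = eLpNorm u 2 volume := by
  rw [← enorm_toLp_eq, ← enorm_toLp_eq, ← ofReal_norm, ← ofReal_norm,
    SchwartzMap.norm_fourier_toL2_eq]

theorem eLpNorm_fourierInv (u : 𝓢(EuclideanSpace ℝ (Fin n), ℂ)) :
    eLpNorm (𝓕⁻ u : 𝓢(EuclideanSpace ℝ (Fin n), ℂ)) 2 volume = eLpNorm u 2 volume := by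
  rw [← eLpNorm_fourier, FourierTransform.fourier_fourierInv_eq]

theorem fourier_fourier_apply (u : 𝓢(EuclideanSpace ℝ (Fin n), ℂ))
    (x : EuclideanSpace ℝ (Fin n)) : 𝓕 (𝓕 u) x = u (-x) := by
  have h : 𝓕⁻ (𝓕 u) = u := FourierTransform.fourierInv_fourier_eq u
  conv_rhs => rw [← h]
  rw [SchwartzMap.fourierInv_coe, Real.fourierInv_eq_fourier_neg, neg_neg, SchwartzMap.fourier_coe]

theorem weightedNorm_fourier_fourier (N : ℝ) (u : 𝓢(EuclideanSpace ℝ (Fin n), ℂ)) :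
    weightedNorm N (𝓕 (𝓕 u)) = weightedNorm N u := by
  have h := eLpNorm_comp_measurePreserving (p := 2) (aestronglyMeasurable_weight_mul N u volume)
    (Measure.measurePreserving_neg (volume : Measure (EuclideanSpace ℝ (Fin n))))
  rw [weightedNorm, weightedNorm, ← h]
  congr 1
  ext x
  simp [fourier_fourier_apply, weight]

/-- Young's inequality with weights, for the Fourier multiplier with symbol `ζ`. -/
theorem weightedNorm_fourierInv_mul_fourier_le (N : ℝ) (ζ v : 𝓢(EuclideanSpace ℝ (Fin n), ℂ)) :
    weightedNorm N (𝓕⁻ (SchwartzMap.smulLeftCLM ℂ ζ (𝓕 v)))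
      ≤ ENNReal.ofReal (2 ^ |N|) * (∫⁻ x, ENNReal.ofReal (weight |N| x) * ‖𝓕⁻ ζ x‖ₑ)
        * weightedNorm N v := by
  set κ := 𝓕⁻ ζ with hκ
  set I := ∫⁻ x, ENNReal.ofReal (weight |N| x) * ‖κ x‖ₑ with hI
  set k : EuclideanSpace ℝ (Fin n) → ℝ≥0∞ :=
    fun x => ENNReal.ofReal (2 ^ |N|) * (ENNReal.ofReal (weight |N| x) * ‖κ x‖ₑ) with hk
  have hkm : Measurable k :=
    ((continuous_weight |N|).measurable.ennreal_ofReal.mul κ.continuous.measurable.enorm).const_mul _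
  have hkI : ∫⁻ x, k x = ENNReal.ofReal (2 ^ |N|) * I :=
    lintegral_const_mul _
      ((continuous_weight |N|).measurable.ennreal_ofReal.mul κ.continuous.measurable.enorm)
  have hconv : ∀ x, 𝓕⁻ (SchwartzMap.smulLeftCLM ℂ ζ (𝓕 v)) x = ∫ y, κ (x - y) * v y := fun x => by
    have h1 : 𝓕⁻ (SchwartzMap.smulLeftCLM ℂ ζ (𝓕 v))
        = SchwartzMap.convolution (ContinuousLinearMap.mul ℂ ℂ) κ v := by
      have h2 : 𝓕⁻ (𝓕 (SchwartzMap.convolution (ContinuousLinearMap.mul ℂ ℂ) κ v))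
          = SchwartzMap.convolution (ContinuousLinearMap.mul ℂ ℂ) κ v :=
        FourierTransform.fourierInv_fourier_eq _
      rw [← h2, SchwartzMap.fourier_convolution, hκ, FourierTransform.fourier_fourierInv_eq]
      congr 1
      ext y
      simp [SchwartzMap.smulLeftCLM_apply_apply ζ.hasTemperateGrowth]
    rw [h1, SchwartzMap.convolution_apply, convolution_eq_swap]
    rfl
  have hpt : ∀ x, ‖(weight N x : ℂ) * 𝓕⁻ (SchwartzMap.smulLeftCLM ℂ ζ (𝓕 v)) x‖ₑ
      ≤ ∫⁻ y, k (x - y) * ‖(weight N y : ℂ) * v y‖ₑ := fun x => by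
    rw [hconv, ← integral_const_mul]
    refine (enorm_integral_le_lintegral_enorm _).trans (lintegral_mono fun y => ?_)
    have hw := ENNReal.ofReal_le_ofReal (weight_le_mul_weight_sub N x y)
    rw [ENNReal.ofReal_mul (by positivity), ENNReal.ofReal_mul (weight_pos _ _).le] at hw
    have hen : ∀ z : EuclideanSpace ℝ (Fin n), ‖(weight N z : ℂ)‖ₑ = ENNReal.ofReal (weight N z) :=
      fun z => by rw [← ofReal_norm, Complex.norm_of_nonneg (weight_pos N z).le]
    simp only [hk, enorm_mul, hen]
    calc _ ≤ _ := mul_le_mul_left hw _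
      _ = _ := by ring
  have hschur := lintegral_sq_lintegral_mul_le (μ := volume) (ν := volume)
    (K := fun x y : EuclideanSpace ℝ (Fin n) => k (x - y))
    (a := fun y => ‖(weight N y : ℂ) * v y‖ₑ) (hkm.comp measurable_sub)
    ((Complex.continuous_ofReal.comp (continuous_weight N)).mul v.continuous).measurable.enorm
    (A := ENNReal.ofReal (2 ^ |N|) * I) (B := ENNReal.ofReal (2 ^ |N|) * I)
    (fun x => by rw [lintegral_sub_left_eq_self k x, hkI])
    (fun y => by rw [lintegral_sub_right_eq_self k y, hkI])
  rw [← ENNReal.pow_le_pow_left_iff two_ne_zero, weightedNorm, weightedNorm, mul_pow, eLpNorm_two_sq,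
    eLpNorm_two_sq]
  refine (lintegral_mono fun x => pow_le_pow_left' (hpt x) 2).trans (hschur.trans_eq ?_)
  rw [sq]

theorem lintegral_weight_mul_lt_top (N : ℝ) (κ : 𝓢(EuclideanSpace ℝ (Fin n), ℂ)) :
    ∫⁻ x, ENNReal.ofReal (weight N x) * ‖κ x‖ₑ < ∞ := by
  have h := (SchwartzMap.smulLeftCLM ℂ (fun x => (weight N x : ℂ)) κ).integrable
    (μ := volume) |>.hasFiniteIntegral
  refine lt_of_eq_of_lt (lintegral_congr fun x => ?_) h
  rw [SchwartzMap.smulLeftCLM_apply_apply (weight_hasTemperateGrowth n N), enorm_smul]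
  rw [← ofReal_norm (weight N x : ℂ), Complex.norm_of_nonneg (weight_pos N x).le]

/-- The convolution kernel of the multiplier with symbol `φ₀(2^(-m) ξ)` is `2^(mn) κ(2^m x)` where
`κ` is the inverse Fourier transform of `φ₀`. Its weighted `L¹`-norm does not grow with `m`. -/
theorem lintegral_weight_mul_fourierInv_dilate_le {N : ℝ} (hN : 0 ≤ N) (m : ℕ)
    (φ₀ : 𝓢(EuclideanSpace ℝ (Fin n), ℂ)) :
    ∫⁻ x, ENNReal.ofReal (weight N x) * ‖𝓕⁻ (dilate φ₀ m) x‖ₑ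
      ≤ ∫⁻ x, ENNReal.ofReal (weight N x) * ‖𝓕⁻ φ₀ x‖ₑ := by
  set r : ℝ := 2 ^ m with hr
  have hr0 : 0 < r := by positivity
  have hr1 : 1 ≤ r := one_le_pow₀ (by norm_num)
  set d := Module.finrank ℝ (EuclideanSpace ℝ (Fin n)) with hd
  have hscale : ∀ x, 𝓕⁻ (dilate φ₀ m) x = ((r ^ d : ℝ) : ℂ) * 𝓕⁻ φ₀ (r • x) := fun x => by
    rw [SchwartzMap.fourierInv_coe, Real.fourierInv_eq', Real.fourierInv_eq']
    have h := Measure.integral_comp_smul (volume : Measure (EuclideanSpace ℝ (Fin n)))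
      (fun v => Complex.exp (2 * Real.pi * (inner ℝ v (r • x) : ℝ) * Complex.I) • φ₀ v) r⁻¹
    have e : ∀ v, Complex.exp (2 * Real.pi * (inner ℝ (r⁻¹ • v) (r • x) : ℝ) * Complex.I)
        • φ₀ (r⁻¹ • v) = Complex.exp (2 * Real.pi * (inner ℝ v x : ℝ) * Complex.I)
          • dilate φ₀ m v := fun v => by
      rw [inner_smul_left, inner_smul_right]
      congr 1
      simp [hr0.ne']
    simp only [e] at h
    rw [inv_pow, inv_inv, abs_of_pos (by positivity), Complex.real_smul] at h
    simpa [hd] using h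
  set G : EuclideanSpace ℝ (Fin n) → ℝ≥0∞ :=
    fun z => ENNReal.ofReal (weight N (r⁻¹ • z)) * ‖𝓕⁻ φ₀ z‖ₑ with hG
  have hGm : Measurable G :=
    (((continuous_weight N).comp (continuous_const_smul _)).measurable.ennreal_ofReal).mul
      (𝓕⁻ φ₀).continuous.measurable.enorm
  calc _ = ∫⁻ x, ENNReal.ofReal (r ^ d) * G (r • x) := by
        refine lintegral_congr fun x => ?_
        simp only [hG]
        rw [hscale, enorm_mul, ← ofReal_norm ((r ^ d : ℝ) : ℂ),
          Complex.norm_of_nonneg (by positivity), smul_smul, inv_mul_cancel₀ hr0.ne', one_smul]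
        ring
    _ = ENNReal.ofReal (r ^ d) * ∫⁻ z, G z ∂(Measure.map (r • ·) volume) := by
        rw [lintegral_map hGm (measurable_const_smul r), lintegral_const_mul]
        exact hGm.comp (measurable_const_smul r)
    _ = ∫⁻ z, G z := by
        rw [Measure.map_addHaar_smul _ hr0.ne', lintegral_smul_measure, smul_eq_mul, ← mul_assoc,
          ← ENNReal.ofReal_mul (by positivity), abs_of_pos (by positivity),
          mul_inv_cancel₀ (by positivity), ENNReal.ofReal_one, one_mul]
    _ ≤ _ := by
        refine lintegral_mono fun z => ?_
        refine mul_le_mul_left (ENNReal.ofReal_le_ofReal ?_) _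
        have hz : ‖r⁻¹ • z‖ ≤ ‖z‖ := by
          rw [norm_smul, norm_inv, Real.norm_of_nonneg hr0.le]
          exact mul_le_of_le_one_left (norm_nonneg _) (inv_le_one_of_one_le₀ hr1)
        unfold weight
        gcongr

theorem exists_schwartzMap_eq_dilate (φ₀ : 𝓢(EuclideanSpace ℝ (Fin n), ℂ)) (m : ℕ) :
    ∃ ζ : 𝓢(EuclideanSpace ℝ (Fin n), ℂ), ⇑ζ = dilate φ₀ m :=
  ⟨SchwartzMap.compCLMOfContinuousLinearEquiv ℂ (LinearEquiv.smulOfNeZero ℝ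
    (EuclideanSpace ℝ (Fin n)) ((2 : ℝ) ^ m)⁻¹ (by positivity)).toContinuousLinearEquiv φ₀, rfl⟩

/-- Smooth multipliers are bounded in weighted `L²`-spaces, uniformly in the dyadic scale. -/
theorem exists_weightedNorm_fourier_mul_fourierInv_le (φ₀ : 𝓢(EuclideanSpace ℝ (Fin n), ℂ))
    (N : ℝ) : ∃ C : ℝ, 0 ≤ C ∧ ∀ η, IsDilationDifference φ₀ η → ∀ u,
      weightedNorm N (𝓕 (SchwartzMap.smulLeftCLM ℂ η (𝓕⁻ u)))
        ≤ ENNReal.ofReal C * weightedNorm N u := by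
  set B := ENNReal.ofReal (2 ^ |N|) * ∫⁻ x, ENNReal.ofReal (weight |N| x) * ‖𝓕⁻ φ₀ x‖ₑ with hB
  have hBtop : B ≠ ∞ :=
    ENNReal.mul_ne_top ENNReal.ofReal_ne_top (lintegral_weight_mul_lt_top |N| (𝓕⁻ φ₀)).ne
  have key : ∀ m u, weightedNorm N (𝓕 (SchwartzMap.smulLeftCLM ℂ (dilate φ₀ m) (𝓕⁻ u)))
      ≤ B * weightedNorm N u := fun m u => by
    obtain ⟨ζ, hζ⟩ := exists_schwartzMap_eq_dilate φ₀ m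
    -- Two Fourier transforms are a reflection, which turns `𝓕 ∘ ζ ∘ 𝓕⁻` into `𝓕⁻ ∘ ζ ∘ 𝓕`.
    have h := weightedNorm_fourierInv_mul_fourier_le N ζ (𝓕⁻ (𝓕⁻ u))
    rw [← weightedNorm_fourier_fourier N (𝓕⁻ (𝓕⁻ u)),
      ← weightedNorm_fourier_fourier N (𝓕⁻ (SchwartzMap.smulLeftCLM ℂ ζ _))] at h
    simp only [FourierTransform.fourier_fourierInv_eq] at h
    rw [← hζ]
    refine h.trans (mul_le_mul_left (mul_le_mul_right ?_ _) _)
    refine le_trans (le_of_eq ?_) (lintegral_weight_mul_fourierInv_dilate_le (abs_nonneg N) m φ₀)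
    rw [SchwartzMap.fourierInv_coe, hζ]
  refine ⟨(2 * B).toReal, ENNReal.toReal_nonneg, fun η hη u => ?_⟩
  rw [ENNReal.ofReal_toReal (ENNReal.mul_ne_top ENNReal.ofNat_ne_top hBtop), two_mul, add_mul]
  rcases hη with ⟨m, rfl⟩ | ⟨m, m', rfl⟩
  · exact (key m u).trans le_self_add
  · rw [SchwartzMap.smulLeftCLM_sub (dilate_hasTemperateGrowth φ₀ m)
      (dilate_hasTemperateGrowth φ₀ m')]
    refine le_trans ?_ (add_le_add (key m u) (key m' u))
    refine le_trans (le_of_eq ?_) (eLpNorm_sub_le (aestronglyMeasurable_weight_mul N _ _)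
      (aestronglyMeasurable_weight_mul N _ _) (by norm_num))
    rw [weightedNorm]
    congr 1
    ext x
    have h : 𝓕 ((SchwartzMap.smulLeftCLM ℂ (dilate φ₀ m) - SchwartzMap.smulLeftCLM ℂ (dilate φ₀ m'))
        (𝓕⁻ u)) = 𝓕 (SchwartzMap.smulLeftCLM ℂ (dilate φ₀ m) (𝓕⁻ u))
          - 𝓕 (SchwartzMap.smulLeftCLM ℂ (dilate φ₀ m') (𝓕⁻ u)) := by
      rw [sub_apply]
      exact map_sub (FourierTransform.fourierCLM ℂ 𝓢(EuclideanSpace ℝ (Fin n), ℂ)) _ _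
    rw [h]
    simp [mul_sub]

/-! ### Convergence of the dyadic resolution on test functions -/

/-- The derivatives of `φ₀(2^(-m) x) - 1` are small of order `2^(-m)`, up to a factor of linear
growth: the function itself vanishes for `|x| ≤ 2^m`, and each derivative gains a factor
`2^(-m)`. -/
theorem exists_norm_iteratedFDeriv_dilate_sub_one_le {φ₀ : 𝓢(EuclideanSpace ℝ (Fin n), ℂ)}
    (hφ : IsDyadicGenerator φ₀) (i : ℕ) : ∃ C : ℝ, 0 ≤ C ∧ ∀ m x,
      ‖iteratedFDeriv ℝ i (fun y => dilate φ₀ m y - 1) x‖ ≤ ((2 : ℝ) ^ m)⁻¹ * (C * (1 + ‖x‖)) := by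
  set B := SchwartzMap.seminorm ℝ 0 i φ₀
  have hB : ∀ x, ‖iteratedFDeriv ℝ i φ₀ x‖ ≤ B :=
    SchwartzMap.norm_iteratedFDeriv_le_seminorm ℝ φ₀ i
  have hB0 : 0 ≤ B := apply_nonneg _ _
  refine ⟨B + 1, by positivity, fun m x => ?_⟩
  have hm : (1 : ℝ) ≤ 2 ^ m := one_le_pow₀ (by norm_num)
  cases i with
  | zero =>
    rw [norm_iteratedFDeriv_zero]
    rcases le_total ‖x‖ (2 ^ m) with hx | hx
    · rw [dilate_eq_one hφ hx, sub_self, norm_zero]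
      positivity
    · have h1 : ‖dilate φ₀ m x - 1‖ ≤ B + 1 := by
        refine (norm_sub_le _ _).trans (add_le_add ?_ (by simp))
        simpa [dilate] using hB (((2 : ℝ) ^ m)⁻¹ • x)
      have h2 : 1 ≤ ((2 : ℝ) ^ m)⁻¹ * (1 + ‖x‖) := by
        rw [inv_mul_eq_div, one_le_div (by positivity)]
        linarith
      calc _ ≤ B + 1 := h1
        _ ≤ (B + 1) * (((2 : ℝ) ^ m)⁻¹ * (1 + ‖x‖)) := le_mul_of_one_le_right (by positivity) h2
        _ = _ := by ring
  | succ i =>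
    have h1 : iteratedFDeriv ℝ (i + 1) (fun y => dilate φ₀ m y - 1) x
        = (((2 : ℝ) ^ m)⁻¹) ^ (i + 1) • iteratedFDeriv ℝ (i + 1) φ₀ (((2 : ℝ) ^ m)⁻¹ • x) := by
      have h2 : ContDiff ℝ (i + 1 : ℕ) (dilate φ₀ m) :=
        (dilate_hasTemperateGrowth φ₀ m).1.of_le (mod_cast le_top)
      have h3 := iteratedFDeriv_sub_apply (x := x) (i := i + 1) h2.contDiffAt
        (contDiff_const (c := (1 : ℂ))).contDiffAt
      change iteratedFDeriv ℝ (i + 1) (dilate φ₀ m - fun _ => (1 : ℂ)) x = _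
      rw [h3, iteratedFDeriv_const_of_ne (by omega), Pi.zero_apply, sub_zero]
      have h4 := iteratedFDeriv_comp_const_smul (i := i + 1) ((2 : ℝ) ^ m)⁻¹ (φ₀.smooth (i + 1 : ℕ))
      exact congrFun h4 x
    rw [h1, norm_smul, norm_pow, norm_inv, Real.norm_of_nonneg (by positivity : (0 : ℝ) ≤ 2 ^ m)]
    have h5 : (((2 : ℝ) ^ m)⁻¹) ^ (i + 1) ≤ ((2 : ℝ) ^ m)⁻¹ :=
      pow_le_of_le_one (by positivity) (inv_le_one_of_one_le₀ hm) (by omega)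
    have h6 : B ≤ (B + 1) * (1 + ‖x‖) := by nlinarith [norm_nonneg x]
    exact mul_le_mul h5 ((hB _).trans h6) (norm_nonneg _) (by positivity)

theorem exists_seminorm_smulLeftCLM_dilate_sub_le {φ₀ : 𝓢(EuclideanSpace ℝ (Fin n), ℂ)}
    (hφ : IsDyadicGenerator φ₀) (h : 𝓢(EuclideanSpace ℝ (Fin n), ℂ)) (k l : ℕ) :
    ∃ M : ℝ, ∀ m, SchwartzMap.seminorm ℝ k l
      (SchwartzMap.smulLeftCLM ℂ (dilate φ₀ m) h - h) ≤ ((2 : ℝ) ^ m)⁻¹ * M := by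
  choose C hC0 hC using exists_norm_iteratedFDeriv_dilate_sub_one_le hφ
  set D : ℕ → ℝ := fun i => SchwartzMap.seminorm ℝ k i h + SchwartzMap.seminorm ℝ (k + 1) i h
  have hD0 : ∀ i, 0 ≤ D i := fun i => add_nonneg (apply_nonneg _ _) (apply_nonneg _ _)
  set M := ∑ i ∈ Finset.range (l + 1), (l.choose i : ℝ) * C i * D (l - i)
  have hM0 : 0 ≤ M := Finset.sum_nonneg fun i _ =>
    mul_nonneg (mul_nonneg (Nat.cast_nonneg _) (hC0 i)) (hD0 _)
  refine ⟨M, fun m => SchwartzMap.seminorm_le_bound ℝ k l _ (by positivity) fun x => ?_⟩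
  have hfun : ⇑(SchwartzMap.smulLeftCLM ℂ (dilate φ₀ m) h - h)
      = fun y => (dilate φ₀ m y - 1) * h y := by
    ext y
    rw [sub_apply, SchwartzMap.smulLeftCLM_apply_apply (dilate_hasTemperateGrowth φ₀ m), sub_mul,
      one_mul, smul_eq_mul]
  have hq : ContDiff ℝ l (fun y => dilate φ₀ m y - 1) :=
    ((dilate_hasTemperateGrowth φ₀ m).1.of_le (mod_cast le_top)).sub contDiff_const
  rw [hfun]
  calc _ ≤ ‖x‖ ^ k * ∑ i ∈ Finset.range (l + 1), (l.choose i : ℝ)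
        * ‖iteratedFDeriv ℝ i (fun y => dilate φ₀ m y - 1) x‖
        * ‖iteratedFDeriv ℝ (l - i) h x‖ := by
        gcongr
        exact norm_iteratedFDeriv_mul_le hq (h.smooth l) x le_rfl
    _ ≤ ∑ i ∈ Finset.range (l + 1), ((2 : ℝ) ^ m)⁻¹ * ((l.choose i : ℝ) * C i * D (l - i)) := by
        rw [Finset.mul_sum]
        refine Finset.sum_le_sum fun i _ => ?_
        have h1 := SchwartzMap.le_seminorm ℝ k (l - i) h x
        have h2 := SchwartzMap.le_seminorm ℝ (k + 1) (l - i) h x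
        have h3 : (1 + ‖x‖) * (‖x‖ ^ k * ‖iteratedFDeriv ℝ (l - i) h x‖) ≤ D (l - i) := by
          refine le_trans (le_of_eq ?_) (add_le_add h1 h2)
          ring
        calc _ ≤ ‖x‖ ^ k * ((l.choose i : ℝ) * (((2 : ℝ) ^ m)⁻¹ * (C i * (1 + ‖x‖)))
              * ‖iteratedFDeriv ℝ (l - i) h x‖) := by
              gcongr
              exact hC i m x
          _ = ((2 : ℝ) ^ m)⁻¹ * ((l.choose i : ℝ) * C i
              * ((1 + ‖x‖) * (‖x‖ ^ k * ‖iteratedFDeriv ℝ (l - i) h x‖))) := by ring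
          _ ≤ _ := by
              have := hC0 i
              gcongr
    _ = _ := by rw [Finset.mul_sum]

theorem tendsto_smulLeftCLM_dilate {φ₀ : 𝓢(EuclideanSpace ℝ (Fin n), ℂ)}
    (hφ : IsDyadicGenerator φ₀) (h : 𝓢(EuclideanSpace ℝ (Fin n), ℂ)) :
    Filter.Tendsto (fun m => SchwartzMap.smulLeftCLM ℂ (dilate φ₀ m) h) Filter.atTop (nhds h) := by
  rw [(schwartz_withSeminorms ℝ (EuclideanSpace ℝ (Fin n)) ℂ).tendsto_nhds]
  rintro ⟨k, l⟩ ε hε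
  obtain ⟨M, hM⟩ := exists_seminorm_smulLeftCLM_dilate_sub_le hφ h k l
  have h2 : Filter.Tendsto (fun m : ℕ => ((2 : ℝ) ^ m)⁻¹ * M) Filter.atTop (nhds 0) := by
    have h3 := (tendsto_inv_atTop_zero.comp
      (tendsto_pow_atTop_atTop_of_one_lt (by norm_num : (1 : ℝ) < 2))).mul_const M
    simpa using h3
  filter_upwards [h2.eventually_lt_const hε] with m hm
  exact (hM m).trans_lt hm

theorem tendsto_sum_smulLeftCLM_dyadic {φ₀ : 𝓢(EuclideanSpace ℝ (Fin n), ℂ)}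
    (hφ : IsDyadicGenerator φ₀) (h : 𝓢(EuclideanSpace ℝ (Fin n), ℂ)) :
    Filter.Tendsto (fun m => ∑ j ∈ Finset.range m, SchwartzMap.smulLeftCLM ℂ (dyadic φ₀ j) h)
      Filter.atTop (nhds h) := by
  rw [← Filter.tendsto_add_atTop_iff_nat 1]
  refine (tendsto_smulLeftCLM_dilate hφ h).congr fun m => ?_
  have hd : dilate φ₀ m = fun x => ∑ j ∈ Finset.range (m + 1), dyadic φ₀ j x :=
    funext fun x => (sum_dyadic φ₀ m x).symm
  rw [hd, SchwartzMap.smulLeftCLM_sum fun j _ => dyadic_hasTemperateGrowth φ₀ j, sum_apply]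

theorem enorm_le_tsum_dyadic {φ₀ : 𝓢(EuclideanSpace ℝ (Fin n), ℂ)} (hφ : IsDyadicGenerator φ₀)
    (L : 𝓢'(EuclideanSpace ℝ (Fin n), ℂ)) (h : 𝓢(EuclideanSpace ℝ (Fin n), ℂ)) :
    ‖L h‖ₑ ≤ ∑' j, ‖L (SchwartzMap.smulLeftCLM ℂ (dyadic φ₀ j) h)‖ₑ := by
  refine enorm_le_tsum_of_tendsto ?_
  have := ((map_continuous L).tendsto h).comp (tendsto_sum_smulLeftCLM_dyadic hφ h)
  refine this.congr fun m => ?_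
  rw [Function.comp_apply, map_sum]

/-! ### Localization in phase space -/

/-- The part of `ℝⁿ` where `2^l ≤ (1 + |x|²)^(1/2) < 2^(l+1)`. -/
def shell (l : ℕ) : Set (EuclideanSpace ℝ (Fin n)) := shellIndex ⁻¹' {l}

theorem measurableSet_shell (l : ℕ) : MeasurableSet (shell l : Set (EuclideanSpace ℝ (Fin n))) :=
  measurable_shellIndex (measurableSet_singleton l)

theorem mem_fatShell_of_mem_shell {l : ℕ} {x : EuclideanSpace ℝ (Fin n)} (hx : x ∈ shell l) :
    x ∈ fatShell l := by
  have h : shellIndex x = l := hx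
  exact h ▸ mem_fatShell_shellIndex x

theorem lintegral_eq_tsum_shell (F : EuclideanSpace ℝ (Fin n) → ℝ≥0∞) :
    ∫⁻ x, F x = ∑' l, ∫⁻ x in shell l, F x := by
  have hu : (⋃ l, (shell l : Set (EuclideanSpace ℝ (Fin n)))) = Set.univ :=
    Set.eq_univ_of_forall fun x => Set.mem_iUnion.2 ⟨shellIndex x, rfl⟩
  rw [← lintegral_iUnion measurableSet_shell, hu, setLIntegral_univ]
  intro a b hab
  exact Disjoint.preimage _ (Set.disjoint_singleton.2 hab)

theorem eLpNorm_two_eq_rpow {β F : Type*} [MeasurableSpace β] [NormedAddCommGroup F] (f : β → F)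
    (μ : Measure β) : eLpNorm f 2 μ = (∫⁻ x, ‖f x‖ₑ ^ 2 ∂μ) ^ (1 / 2 : ℝ) := by
  rw [← eLpNorm_two_sq, ← ENNReal.rpow_natCast, ← ENNReal.rpow_mul]
  norm_num

theorem tsum_eLpNorm_shell_sq (g : EuclideanSpace ℝ (Fin n) → ℂ) :
    ∑' l, eLpNorm g 2 (volume.restrict (shell l)) ^ 2 = eLpNorm g 2 volume ^ 2 := by
  simp only [eLpNorm_two_sq]
  exact (lintegral_eq_tsum_shell _).symm

theorem enorm_integral_mul_le_tsum_shell {u g : EuclideanSpace ℝ (Fin n) → ℂ}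
    (hu : AEStronglyMeasurable u volume) (hg : AEStronglyMeasurable g volume) :
    ‖∫ x, u x * g x‖ₑ ≤ ∑' l, eLpNorm u 2 (volume.restrict (shell l))
      * eLpNorm g 2 (volume.restrict (shell l)) := by
  refine (enorm_integral_le_lintegral_enorm _).trans ?_
  rw [lintegral_eq_tsum_shell]
  refine ENNReal.tsum_le_tsum fun l => ?_
  have h := ENNReal.lintegral_mul_le_Lp_mul_Lq (volume.restrict (shell l)) (p := 2) (q := 2)
    (f := fun x => ‖u x‖ₑ) (g := fun x => ‖g x‖ₑ) (by constructor <;> norm_num)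
    hu.enorm.restrict hg.enorm.restrict
  simp only [Pi.mul_apply, ENNReal.rpow_two, ← eLpNorm_two_eq_rpow] at h
  simpa only [enorm_mul] using h

/-- On a shell all weights are comparable to constants. -/
theorem eLpNorm_weight_mul_shell_le (N β : ℝ) (l : ℕ) (u : 𝓢(EuclideanSpace ℝ (Fin n), ℂ)) :
    eLpNorm (fun x => (weight β x : ℂ) * u x) 2 (volume.restrict (shell l))
      ≤ ENNReal.ofReal (4 ^ |N| * 2 ^ (-(N * l))) * weightedNorm (N + β) u := by
  refine le_trans ?_ (mul_le_mul_right (eLpNorm_mono_measure _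
    (Measure.restrict_le_self (s := shell l))) _)
  refine eLpNorm_le_mul_eLpNorm_of_ae_le_mul ?_ 2
  filter_upwards [ae_restrict_mem (measurableSet_shell l)] with x hx
  have h := one_le_of_mem_fatShell N (mem_fatShell_of_mem_shell hx)
  rw [norm_weight_mul, norm_weight_mul, weight_add]
  calc _ = 1 * (weight β x * ‖u x‖) := (one_mul _).symm
    _ ≤ (4 ^ |N| * 2 ^ (-(N * l)) * weight N x) * (weight β x * ‖u x‖) := by
      have := weight_pos β x
      gcongr
    _ = _ := by ring

theorem weightedNorm_smulLeftCLM_of_fatShell_le {η : EuclideanSpace ℝ (Fin n) → ℂ}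
    (hη : η.HasTemperateGrowth) {j : ℕ} (hsupp : ∀ x, η x ≠ 0 → x ∈ fatShell j) {B : ℝ}
    (hB : ∀ x, ‖η x‖ ≤ B) (N M : ℝ) (u : 𝓢(EuclideanSpace ℝ (Fin n), ℂ)) :
    weightedNorm N (SchwartzMap.smulLeftCLM ℂ η u)
      ≤ ENNReal.ofReal (4 ^ |N - M| * 2 ^ ((N - M) * j) * B) * weightedNorm M u := by
  refine weightedNorm_smulLeftCLM_le hη (fun x => ?_) u
  by_cases hx : η x = 0
  · have hB0 : 0 ≤ B := (norm_nonneg _).trans (hB x)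
    rw [hx, norm_zero, mul_zero]
    have := weight_pos M x
    positivity
  · have h := weight_le_of_mem_fatShell (N - M) (hsupp x hx)
    have hN : weight N x = weight (N - M) x * weight M x := by rw [← weight_add, sub_add_cancel]
    have := weight_pos M x
    calc _ = weight (N - M) x * ‖η x‖ * weight M x := by rw [hN]; ring
      _ ≤ _ := by
        gcongr
        exact hB x

/-- The `L²`-norms of the pieces of a dyadic resolution are square summable. -/
theorem exists_tsum_sq_eLpNorm_dyadic_le {φ₀ : 𝓢(EuclideanSpace ℝ (Fin n), ℂ)}
    (hφ : IsDyadicGenerator φ₀) : ∃ C : ℝ, 0 ≤ C ∧ ∀ h : 𝓢(EuclideanSpace ℝ (Fin n), ℂ),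
      (∑' i, weightedNorm 0 (SchwartzMap.smulLeftCLM ℂ (dyadic φ₀ i) h) ^ 2) ^ (1 / 2 : ℝ)
        ≤ ENNReal.ofReal C * eLpNorm h 2 volume := by
  obtain ⟨B, hB0, hB⟩ := exists_norm_le_of_isDilationDifference φ₀
  have hpt : ∀ x, ∑' i, ‖dyadic φ₀ i x‖ₑ ^ 2 ≤ ENNReal.ofReal (8 * B ^ 2 * 3) := fun x => by
    have hle : ∀ i, ‖dyadic φ₀ i x‖ₑ ^ 2
        ≤ ENNReal.ofReal (8 * B ^ 2) * dyadicDecay (shellIndex x) i := fun i => by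
      by_cases hx : dyadic φ₀ i x = 0
      · simp [hx]
      · have h1 := abs_sub_shellIndex_le_of_mem_fatShell (mem_fatShell_of_dyadic_ne_zero hφ hx)
        have h2 : (8 : ℝ)⁻¹ ≤ 2 ^ (-|(shellIndex x : ℝ) - i|) := by
          calc (8 : ℝ)⁻¹ = 2 ^ (-3 : ℝ) := by
                rw [Real.rpow_neg (by norm_num)]
                norm_num
            _ ≤ _ := Real.rpow_le_rpow_of_exponent_le (by norm_num) (by linarith)
        rw [← ofReal_norm, ← ENNReal.ofReal_pow (norm_nonneg _), dyadicDecay,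
          ← ENNReal.ofReal_mul (by positivity)]
        refine ENNReal.ofReal_le_ofReal ?_
        calc ‖dyadic φ₀ i x‖ ^ 2 ≤ B ^ 2 := by
              gcongr
              exact hB _ (isDilationDifference_dyadic φ₀ i) x
          _ = 8 * B ^ 2 * 8⁻¹ := by ring
          _ ≤ _ := by gcongr
    refine (ENNReal.tsum_le_tsum hle).trans ?_
    rw [ENNReal.tsum_mul_left, ENNReal.ofReal_mul (p := 8 * B ^ 2) (by positivity)]
    gcongr
    simpa using tsum_dyadicDecay_le (shellIndex x)
  refine ⟨√(8 * B ^ 2 * 3), Real.sqrt_nonneg _, fun h => ?_⟩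
  have hsum : ∑' i, weightedNorm 0 (SchwartzMap.smulLeftCLM ℂ (dyadic φ₀ i) h) ^ 2
      ≤ ENNReal.ofReal (8 * B ^ 2 * 3) * eLpNorm h 2 volume ^ 2 := by
    simp only [weightedNorm_zero, eLpNorm_two_sq]
    rw [← lintegral_tsum fun i =>
      ((SchwartzMap.continuous _).measurable.enorm.pow_const 2).aemeasurable,
      ← lintegral_const_mul _ (h.continuous.measurable.enorm.pow_const 2)]
    refine lintegral_mono fun x => ?_
    simp only [SchwartzMap.smulLeftCLM_apply_apply (dyadic_hasTemperateGrowth φ₀ _), enorm_smul,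
      mul_pow, ENNReal.tsum_mul_right]
    gcongr
    exact hpt x
  refine (ENNReal.rpow_le_rpow hsum (by norm_num)).trans (le_of_eq ?_)
  rw [ENNReal.mul_rpow_of_nonneg _ _ (by norm_num), ← ENNReal.rpow_natCast, ← ENNReal.rpow_mul,
    ENNReal.ofReal_rpow_of_nonneg (by positivity) (by norm_num), Real.sqrt_eq_rpow]
  norm_num

/-- The function `θ^∨`, localized in space by `ψ` and then in frequency by `χ`, that is
`χ(D) (ψ θ^∨)`, up to a reflection. The outer transform is `𝓕` instead of `𝓕⁻` because of the way
in which the transposed operators act on test functions. -/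
def phaseLocalization (χ ψ : EuclideanSpace ℝ (Fin n) → ℂ)
    (θ : 𝓢(EuclideanSpace ℝ (Fin n), ℂ)) : 𝓢(EuclideanSpace ℝ (Fin n), ℂ) :=
  𝓕 (SchwartzMap.smulLeftCLM ℂ χ (𝓕 (SchwartzMap.smulLeftCLM ℂ ψ (𝓕⁻ θ))))

theorem weightedNorm_dyadic_weight_le {φ₀ : 𝓢(EuclideanSpace ℝ (Fin n), ℂ)}
    (hφ : IsDyadicGenerator φ₀) (N s : ℝ) (i : ℕ) (h : 𝓢(EuclideanSpace ℝ (Fin n), ℂ)) :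
    weightedNorm N (SchwartzMap.smulLeftCLM ℂ (dyadic φ₀ i)
        (SchwartzMap.smulLeftCLM ℂ (fun x => (weight s x : ℂ)) h))
      ≤ ENNReal.ofReal (4 ^ |N + s| * 2 ^ ((N + s) * i))
        * weightedNorm 0 (SchwartzMap.smulLeftCLM ℂ (dyadic φ₀ i) h) := by
  refine eLpNorm_le_mul_eLpNorm_of_ae_le_mul (Filter.Eventually.of_forall fun x => ?_) 2
  rw [norm_weight_mul, norm_weight_mul]
  simp only [weight_zero, one_mul, norm_smul,
    SchwartzMap.smulLeftCLM_apply_apply (dyadic_hasTemperateGrowth φ₀ i),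
    SchwartzMap.smulLeftCLM_apply_apply (weight_hasTemperateGrowth n s),
    Complex.norm_of_nonneg (weight_pos s x).le]
  by_cases hx : dyadic φ₀ i x = 0
  · simp [hx]
  · have h1 := weight_le_of_mem_fatShell (N + s) (mem_fatShell_of_dyadic_ne_zero hφ hx)
    calc _ = weight (N + s) x * (‖dyadic φ₀ i x‖ * ‖h x‖) := by rw [weight_add]; ring
      _ ≤ _ := by gcongr

theorem le_ofReal_mul_trans {a b c : ℝ≥0∞} {x y : ℝ} (hx : 0 ≤ x) (hab : a ≤ ENNReal.ofReal x * b)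
    (hbc : b ≤ ENNReal.ofReal y * c) : a ≤ ENNReal.ofReal (x * y) * c := by
  rw [ENNReal.ofReal_mul hx, mul_assoc]
  exact hab.trans (mul_le_mul_right hbc _)

/-- The interaction of the shells `k` and `l` in space decays, because `χ_j(D)` is bounded in the
weighted space with weight `w_(N+β)`. -/
theorem exists_eLpNorm_phaseLocalization_le_space {φ₀ ψ₀ : 𝓢(EuclideanSpace ℝ (Fin n), ℂ)}
    (hφ : IsDyadicGenerator φ₀) (hψ : IsDyadicGenerator ψ₀) (N β s : ℝ) :
    ∃ C : ℝ, 0 ≤ C ∧ ∀ (i j k l : ℕ) (h : 𝓢(EuclideanSpace ℝ (Fin n), ℂ)),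
      eLpNorm (fun x => (weight β x : ℂ) * phaseLocalization (fatDyadic φ₀ j) (dyadic ψ₀ k)
        (SchwartzMap.smulLeftCLM ℂ (dyadic φ₀ i)
          (SchwartzMap.smulLeftCLM ℂ (fun x => (weight s x : ℂ)) h)) x) 2
          (volume.restrict (shell l))
        ≤ ENNReal.ofReal (C * 2 ^ (N * k - N * l + β * k + s * i))
          * weightedNorm 0 (SchwartzMap.smulLeftCLM ℂ (dyadic φ₀ i) h) := by
  obtain ⟨C₁, hC₁, h₁⟩ := exists_weightedNorm_fourier_mul_fourierInv_le φ₀ (N + β)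
  obtain ⟨B, hB0, hB⟩ := exists_norm_le_of_isDilationDifference ψ₀
  refine ⟨4 ^ |N| * C₁ * (4 ^ |N + β| * B) * 4 ^ |s|, by positivity, fun i j k l h => ?_⟩
  set θ := SchwartzMap.smulLeftCLM ℂ (dyadic φ₀ i)
    (SchwartzMap.smulLeftCLM ℂ (fun x => (weight s x : ℂ)) h)
  set H := SchwartzMap.smulLeftCLM ℂ (dyadic ψ₀ k) (𝓕⁻ θ)
  have e1 := eLpNorm_weight_mul_shell_le N β l (phaseLocalization (fatDyadic φ₀ j) (dyadic ψ₀ k) θ)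
  have e2 : weightedNorm (N + β) (phaseLocalization (fatDyadic φ₀ j) (dyadic ψ₀ k) θ)
      ≤ ENNReal.ofReal C₁ * weightedNorm (N + β) H := by
    have h2 := h₁ _ (isDilationDifference_fatDyadic φ₀ j) (𝓕 (𝓕 H))
    rwa [FourierTransform.fourierInv_fourier_eq, weightedNorm_fourier_fourier] at h2
  have e3 : weightedNorm (N + β) H
      ≤ ENNReal.ofReal (4 ^ |N + β| * 2 ^ ((N + β) * k) * B) * weightedNorm 0 θ := by
    have h3 := weightedNorm_smulLeftCLM_of_fatShell_le (dyadic_hasTemperateGrowth ψ₀ k)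
      (fun x => mem_fatShell_of_dyadic_ne_zero hψ) (hB _ (isDilationDifference_dyadic ψ₀ k))
      (N + β) 0 (𝓕⁻ θ)
    rwa [sub_zero, weightedNorm_zero, eLpNorm_fourierInv, ← weightedNorm_zero] at h3
  have e4 := weightedNorm_dyadic_weight_le hφ 0 s i h
  refine (le_ofReal_mul_trans (by positivity) (le_ofReal_mul_trans (by positivity)
    (le_ofReal_mul_trans (by positivity) e1 e2) e3) e4).trans (le_of_eq ?_)
  congr 2
  rw [zero_add, show N * k - N * l + β * k + s * i = -(N * l) + (N + β) * k + s * i by ring,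
    Real.rpow_add (by norm_num), Real.rpow_add (by norm_num)]
  ring

/-- The interaction of the shells `i` and `j` in frequency decays, because `ψ_k` is bounded in the
Sobolev space of order `N`. -/
theorem exists_eLpNorm_phaseLocalization_le_frequency {φ₀ : 𝓢(EuclideanSpace ℝ (Fin n), ℂ)}
    (hφ : IsDyadicGenerator φ₀) (ψ₀ : 𝓢(EuclideanSpace ℝ (Fin n), ℂ)) (N β s : ℝ) :
    ∃ C : ℝ, 0 ≤ C ∧ ∀ (i j k l : ℕ) (h : 𝓢(EuclideanSpace ℝ (Fin n), ℂ)),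
      eLpNorm (fun x => (weight β x : ℂ) * phaseLocalization (fatDyadic φ₀ j) (dyadic ψ₀ k)
        (SchwartzMap.smulLeftCLM ℂ (dyadic φ₀ i)
          (SchwartzMap.smulLeftCLM ℂ (fun x => (weight s x : ℂ)) h)) x) 2
          (volume.restrict (shell l))
        ≤ ENNReal.ofReal (C * 2 ^ (N * i - N * j + β * l + s * i))
          * weightedNorm 0 (SchwartzMap.smulLeftCLM ℂ (dyadic φ₀ i) h) := by
  obtain ⟨C₁, hC₁, h₁⟩ := exists_weightedNorm_fourier_mul_fourierInv_le ψ₀ N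
  obtain ⟨B, hB0, hB⟩ := exists_norm_le_of_isDilationDifference φ₀
  refine ⟨4 ^ |-β| * (4 ^ |0 - N| * B) * C₁ * 4 ^ |N + s|, by positivity, fun i j k l h => ?_⟩
  set θ := SchwartzMap.smulLeftCLM ℂ (dyadic φ₀ i)
    (SchwartzMap.smulLeftCLM ℂ (fun x => (weight s x : ℂ)) h)
  set H := 𝓕 (SchwartzMap.smulLeftCLM ℂ (dyadic ψ₀ k) (𝓕⁻ θ))
  have e1 := eLpNorm_weight_mul_shell_le (-β) β l
    (phaseLocalization (fatDyadic φ₀ j) (dyadic ψ₀ k) θ)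
  rw [neg_add_cancel, weightedNorm_zero, phaseLocalization, eLpNorm_fourier,
    ← weightedNorm_zero] at e1
  have e2 := weightedNorm_smulLeftCLM_of_fatShell_le
    (isDilationDifference_fatDyadic φ₀ j).hasTemperateGrowth
    (fun x => mem_fatShell_of_fatDyadic_ne_zero hφ) (hB _ (isDilationDifference_fatDyadic φ₀ j))
    0 N H
  have e3 : weightedNorm N H ≤ ENNReal.ofReal C₁ * weightedNorm N θ :=
    h₁ _ (isDilationDifference_dyadic ψ₀ k) θ
  have e4 := weightedNorm_dyadic_weight_le hφ N s i h
  refine (le_ofReal_mul_trans (by positivity) (le_ofReal_mul_trans (by positivity)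
    (le_ofReal_mul_trans (by positivity) e1 e2) e3) e4).trans (le_of_eq ?_)
  congr 2
  rw [show N * i - N * j + β * l + s * i = -(-β * l) + (0 - N) * j + (N + s) * i by ring,
    Real.rpow_add (by norm_num), Real.rpow_add (by norm_num)]
  ring

/-- The best of the decay estimates in space and in frequency, applied with both signs of the
order, yields decay in both variables at once. Here `p`, `q` are the distances between the shells
in frequency and in space. The orders `2(|s| + 1)` and `|α| + 2` are such that the frequency bound
suffices where `(|α| + 1) q ≤ (|s| + 1) p`, and the space bound elsewhere. -/
theorem exponent_le_of_decay {s α x y e p q : ℝ} (hp : p = |x|) (hq : q = |y|)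
    (h1 : e ≤ s * x + (2 * (|s| + 1)) * x + α * y) (h2 : e ≤ s * x - (2 * (|s| + 1)) * x + α * y)
    (h3 : e ≤ s * x + (|α| + 2) * y) (h4 : e ≤ s * x - (|α| + 2) * y) : e ≤ -p - q := by
  have hs : s * x ≤ |s| * p := by rw [hp, ← abs_mul]; exact le_abs_self _
  have hα : α * y ≤ |α| * q := by rw [hq, ← abs_mul]; exact le_abs_self _
  have ha : e ≤ |s| * p - (2 * (|s| + 1)) * p + |α| * q := by
    rcases abs_cases x with ⟨hx, _⟩ | ⟨hx, _⟩ <;> rw [hp, hx] at hs ⊢ <;> linarith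
  have hb : e ≤ |s| * p - (|α| + 2) * q := by
    rcases abs_cases y with ⟨hy, _⟩ | ⟨hy, _⟩ <;> rw [hq, hy] <;> linarith
  have hq0 : 0 ≤ q := hq ▸ abs_nonneg y
  rcases le_total ((|s| + 1) * p) ((|α| + 1) * q) with h | h <;> linarith

/-- The key estimate: the multiplication by `ψ_k` almost preserves the localization to a dyadic
shell in frequency, and the multiplier `χ_j(D)` almost preserves the one in space. -/
theorem exists_eLpNorm_phaseLocalization_le {φ₀ ψ₀ : 𝓢(EuclideanSpace ℝ (Fin n), ℂ)}
    (hφ : IsDyadicGenerator φ₀) (hψ : IsDyadicGenerator ψ₀) (s α : ℝ) :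
    ∃ C : ℝ, 0 ≤ C ∧ ∀ (i j k l : ℕ) (h : 𝓢(EuclideanSpace ℝ (Fin n), ℂ)),
      ENNReal.ofReal (2 ^ (k * α)) * eLpNorm (fun x => (weight (-α) x : ℂ)
        * phaseLocalization (fatDyadic φ₀ j) (dyadic ψ₀ k) (SchwartzMap.smulLeftCLM ℂ (dyadic φ₀ i)
          (SchwartzMap.smulLeftCLM ℂ (fun x => (weight s x : ℂ)) h)) x) 2
          (volume.restrict (shell l))
        ≤ ENNReal.ofReal C * (weightedNorm 0 (SchwartzMap.smulLeftCLM ℂ (dyadic φ₀ i) h)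
          * (dyadicDecay i j * dyadicDecay k l * ENNReal.ofReal (2 ^ (j * s)))) := by
  obtain ⟨C₁, hC₁, h₁⟩ :=
    exists_eLpNorm_phaseLocalization_le_frequency hφ ψ₀ (2 * (|s| + 1)) (-α) s
  obtain ⟨C₂, hC₂, h₂⟩ :=
    exists_eLpNorm_phaseLocalization_le_frequency hφ ψ₀ (-(2 * (|s| + 1))) (-α) s
  obtain ⟨C₃, hC₃, h₃⟩ := exists_eLpNorm_phaseLocalization_le_space hφ hψ (|α| + 2) (-α) s
  obtain ⟨C₄, hC₄, h₄⟩ := exists_eLpNorm_phaseLocalization_le_space hφ hψ (-(|α| + 2)) (-α) s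
  set C := C₁ + C₂ + C₃ + C₄
  refine ⟨C, by positivity, fun i j k l h => ?_⟩
  set d := weightedNorm 0 (SchwartzMap.smulLeftCLM ℂ (dyadic φ₀ i) h)
  set T := eLpNorm (fun x => (weight (-α) x : ℂ)
        * phaseLocalization (fatDyadic φ₀ j) (dyadic ψ₀ k) (SchwartzMap.smulLeftCLM ℂ (dyadic φ₀ i)
          (SchwartzMap.smulLeftCLM ℂ (fun x => (weight s x : ℂ)) h)) x) 2
          (volume.restrict (shell l))
  -- The bounds in frequency and in space, with both signs of the order, are combined by taking the
  -- smallest of the four exponents.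
  set e₁ := 2 * (|s| + 1) * i - 2 * (|s| + 1) * j + -α * l + s * i with he₁
  set e₂ := -(2 * (|s| + 1)) * i - -(2 * (|s| + 1)) * j + -α * l + s * i with he₂
  set e₃ := (|α| + 2) * k - (|α| + 2) * l + -α * k + s * i with he₃
  set e₄ := -(|α| + 2) * k - -(|α| + 2) * l + -α * k + s * i with he₄
  have hT : T ≤ ENNReal.ofReal (C * 2 ^ (min (min e₁ e₂) (min e₃ e₄))) * d := by
    have hmono : ∀ {c e : ℝ}, c ≤ C → T ≤ ENNReal.ofReal (c * 2 ^ e) * d →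
        T ≤ ENNReal.ofReal (C * 2 ^ e) * d := fun hc hT => hT.trans (by gcongr)
    rcases min_choice (min e₁ e₂) (min e₃ e₄) with hm | hm <;> rw [hm]
    · rcases min_choice e₁ e₂ with hm | hm <;> rw [hm]
      · exact hmono (by simp only [C]; linarith) (h₁ i j k l h)
      · exact hmono (by simp only [C]; linarith) (h₂ i j k l h)
    · rcases min_choice e₃ e₄ with hm | hm <;> rw [hm]
      · exact hmono (by simp only [C]; linarith) (h₃ i j k l h)
      · exact hmono (by simp only [C]; linarith) (h₄ i j k l h)
  set e := min (min e₁ e₂) (min e₃ e₄)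
  have hle₁ : e ≤ e₁ := (min_le_left _ _).trans (min_le_left _ _)
  have hle₂ : e ≤ e₂ := (min_le_left _ _).trans (min_le_right _ _)
  have hle₃ : e ≤ e₃ := (min_le_right _ _).trans (min_le_left _ _)
  have hle₄ : e ≤ e₄ := (min_le_right _ _).trans (min_le_right _ _)
  have hexp : k * α + e ≤ -|(i : ℝ) - j| + -|(k : ℝ) - l| + j * s := by
    have := exponent_le_of_decay (s := s) (α := α) (x := (i : ℝ) - j) (y := (k : ℝ) - l)
      (e := k * α + e - j * s) rfl rfl (by rw [he₁] at hle₁; linarith)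
      (by rw [he₂] at hle₂; linarith) (by rw [he₃] at hle₃; linarith)
      (by rw [he₄] at hle₄; linarith)
    linarith
  calc ENNReal.ofReal (2 ^ (k * α)) * T
      ≤ ENNReal.ofReal (2 ^ (k * α)) * (ENNReal.ofReal (C * 2 ^ e) * d) := by gcongr
    _ = ENNReal.ofReal (C * 2 ^ (k * α + e)) * d := by
        rw [← mul_assoc, ← ENNReal.ofReal_mul (by positivity), Real.rpow_add (by norm_num)]
        ring_nf
    _ ≤ ENNReal.ofReal (C * 2 ^ (-|(i : ℝ) - j| + -|(k : ℝ) - l| + j * s)) * d := by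
        gcongr
        norm_num
    _ = _ := by
        rw [Real.rpow_add (by norm_num), Real.rpow_add (by norm_num),
          ENNReal.ofReal_mul (by positivity), ENNReal.ofReal_mul (by positivity),
          ENNReal.ofReal_mul (by positivity), dyadicDecay, dyadicDecay]
        ring

/-! ### The Fourier transform is bounded -/

/-- The pairing of `w_α^(-1) g`, with `g ∈ L²`, and a Schwartz function, split into the
contributions of the shells. -/
theorem enorm_apply_le_tsum_shell {u : 𝓢'(EuclideanSpace ℝ (Fin n), ℂ)} {α : ℝ}
    {g : Lp ℂ 2 (volume : Measure (EuclideanSpace ℝ (Fin n)))}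
    (hg : (g : 𝓢'(EuclideanSpace ℝ (Fin n), ℂ))
      = TemperedDistribution.smulLeftCLM ℂ (fun x => (weight α x : ℂ)) u)
    (Z : 𝓢(EuclideanSpace ℝ (Fin n), ℂ)) :
    ‖u Z‖ₑ ≤ ∑' l, eLpNorm (fun x => (weight (-α) x : ℂ) * Z x) 2 (volume.restrict (shell l))
      * eLpNorm g 2 (volume.restrict (shell l)) := by
  have h1 : u Z = ∫ x, ((weight (-α) x : ℂ) * Z x) * g x := by
    have h2 : SchwartzMap.smulLeftCLM ℂ (fun x => (weight α x : ℂ))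
        (SchwartzMap.smulLeftCLM ℂ (fun x => (weight (-α) x : ℂ)) Z) = Z := by
      ext x
      rw [SchwartzMap.smulLeftCLM_apply_apply (weight_hasTemperateGrowth n α),
        SchwartzMap.smulLeftCLM_apply_apply (weight_hasTemperateGrowth n (-α)), smul_smul,
        ← Complex.ofReal_mul, weight_mul_weight_neg, Complex.ofReal_one, one_smul]
    have h3 := DFunLike.congr_fun hg (SchwartzMap.smulLeftCLM ℂ (fun x => (weight (-α) x : ℂ)) Z)
    rw [TemperedDistribution.smulLeftCLM_apply_apply, h2, Lp.toTemperedDistribution_apply] at h3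
    rw [← h3]
    refine integral_congr_ae (Filter.Eventually.of_forall fun x => ?_)
    simp only [SchwartzMap.smulLeftCLM_apply_apply (weight_hasTemperateGrowth n (-α)), smul_eq_mul]
  rw [h1]
  exact enorm_integral_mul_le_tsum_shell (aestronglyMeasurable_weight_mul _ _ _)
    (Lp.aestronglyMeasurable g)

/-- The double dyadic decomposition, in space and in frequency, of a test function. -/
theorem enorm_fourierMultiplierCLM_fourier_apply_le {φ₀ : 𝓢(EuclideanSpace ℝ (Fin n), ℂ)}
    (hφ : IsDyadicGenerator φ₀) (f : 𝓢'(EuclideanSpace ℝ (Fin n), ℂ))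
    (ψ : EuclideanSpace ℝ (Fin n) → ℂ) (h : 𝓢(EuclideanSpace ℝ (Fin n), ℂ)) :
    ‖TemperedDistribution.fourierMultiplierCLM ℂ ψ (𝓕 f) h‖ₑ
      ≤ ∑' i, ∑' j, ‖TemperedDistribution.fourierMultiplierCLM ℂ (dyadic φ₀ j) f
        (phaseLocalization (fatDyadic φ₀ j) ψ (SchwartzMap.smulLeftCLM ℂ (dyadic φ₀ i) h))‖ₑ := by
  refine (enorm_le_tsum_dyadic hφ _ h).trans (ENNReal.tsum_le_tsum fun i => ?_)
  refine (enorm_le_tsum_dyadic hφ (𝓕 f) _).trans (ENNReal.tsum_le_tsum fun j => le_of_eq ?_)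
  rw [TemperedDistribution.fourierMultiplierCLM_apply_apply, TemperedDistribution.fourier_apply,
    phaseLocalization, FourierTransform.fourierInv_fourier_eq,
    SchwartzMap.smulLeftCLM_smulLeftCLM_apply (dyadic_hasTemperateGrowth φ₀ j)
      (isDilationDifference_fatDyadic φ₀ j).hasTemperateGrowth, mul_comm, fatDyadic_mul_dyadic hφ]
  rfl

theorem exists_sobolevNorm_fourier_le {φ₀ ψ₀ : 𝓢(EuclideanSpace ℝ (Fin n), ℂ)}
    (hφ : IsDyadicGenerator φ₀) (hψ : IsDyadicGenerator ψ₀) (s α : ℝ) :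
    ∃ C : ℝ, 0 < C ∧ ∀ f : 𝓢'(EuclideanSpace ℝ (Fin n), ℂ),
      sobolevNorm ψ₀ α s (𝓕 f) ≤ ENNReal.ofReal C * sobolevNorm φ₀ s α f := by
  obtain ⟨C₁, hC₁, h₁⟩ := exists_eLpNorm_phaseLocalization_le hφ hψ s α
  obtain ⟨C₂, hC₂, h₂⟩ := exists_tsum_sq_eLpNorm_dyadic_le hφ
  have hCpos : 0 < C₁ * C₂ * 9 + 1 := by positivity
  refine ⟨C₁ * C₂ * 9 + 1, hCpos, fun f => ?_⟩
  by_cases htop : sobolevNorm φ₀ s α f = ∞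
  · rw [htop, ENNReal.mul_top (by simpa using hCpos)]
    exact le_top
  set u : ℕ → 𝓢'(EuclideanSpace ℝ (Fin n), ℂ) :=
    fun j => TemperedDistribution.fourierMultiplierCLM ℂ (dyadic φ₀ j) f with hu
  have hsum : ∑' j : ℕ, (ENNReal.ofReal ((2 : ℝ) ^ ((j : ℝ) * s)) * weightedL2Norm α (u j)) ^ 2
      ≠ ∞ := fun h => htop (by
    unfold sobolevNorm
    rw [h]
    exact ENNReal.top_rpow_of_pos (by norm_num))
  have hfin : ∀ j, weightedL2Norm α (u j) ≠ ∞ := fun j hj => by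
    refine ENNReal.ne_top_of_tsum_ne_top hsum j ?_
    rw [hj, ENNReal.mul_top]
    · simp
    · simpa using Real.rpow_pos_of_pos two_pos _
  choose g hg hgn using fun j => exists_lp_enorm_le_l2Norm (hfin j)
  set a : ℕ → ℕ → ℝ≥0∞ := fun j l =>
    ENNReal.ofReal (2 ^ (j * s)) * eLpNorm (g j) 2 (volume.restrict (shell l)) with ha
  set e : ℕ → ℕ → ℝ≥0∞ := fun k i => ∑' j, ∑' l, dyadicDecay i j * dyadicDecay k l * a j l with he
  have haA : ∑' j, ∑' l, a j l ^ 2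
      ≤ ∑' j : ℕ, (ENNReal.ofReal ((2 : ℝ) ^ ((j : ℝ) * s)) * weightedL2Norm α (u j)) ^ 2 := by
    refine ENNReal.tsum_le_tsum fun j => ?_
    simp only [ha, mul_pow]
    rw [ENNReal.tsum_mul_left, tsum_eLpNorm_shell_sq, ← Lp.enorm_def]
    gcongr
    exact hgn j
  have hk : ∀ k : ℕ, ENNReal.ofReal ((2 : ℝ) ^ ((k : ℝ) * α)) * weightedL2Norm s
      (TemperedDistribution.fourierMultiplierCLM ℂ (dyadic ψ₀ k) (𝓕 f))
        ≤ ENNReal.ofReal (C₁ * C₂) * (∑' i, e k i ^ 2) ^ (1 / 2 : ℝ) := fun k => by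
    have hp : (0 : ℝ) < 2 ^ ((k : ℝ) * α) := Real.rpow_pos_of_pos two_pos _
    rw [mul_comm, ← ENNReal.le_div_iff_mul_le (Or.inl (by simpa using hp))
      (Or.inl ENNReal.ofReal_ne_top)]
    refine l2Norm_le_of_forall_enorm_le fun h => ?_
    rw [ENNReal.mul_comm_div, ← mul_div_assoc, ENNReal.le_div_iff_mul_le
      (Or.inl (by simpa using hp)) (Or.inl ENNReal.ofReal_ne_top), mul_comm,
      TemperedDistribution.smulLeftCLM_apply_apply]
    set w : 𝓢(EuclideanSpace ℝ (Fin n), ℂ) := SchwartzMap.smulLeftCLM ℂ (fun x => (weight s x : ℂ)) h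
    set d : ℕ → ℝ≥0∞ := fun i => weightedNorm 0 (SchwartzMap.smulLeftCLM ℂ (dyadic φ₀ i) h) with hd
    have hterm : ∀ i j, ENNReal.ofReal ((2 : ℝ) ^ ((k : ℝ) * α)) * ‖u j (phaseLocalization
        (fatDyadic φ₀ j) (dyadic ψ₀ k) (SchwartzMap.smulLeftCLM ℂ (dyadic φ₀ i) w))‖ₑ
          ≤ ENNReal.ofReal C₁ * (d i * ∑' l, dyadicDecay i j * dyadicDecay k l * a j l) :=
      fun i j => by
        calc _ ≤ _ := mul_le_mul_right (enorm_apply_le_tsum_shell (hg j) _) _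
          _ ≤ _ := by
            rw [← ENNReal.tsum_mul_left, ← ENNReal.tsum_mul_left, ← ENNReal.tsum_mul_left]
            refine ENNReal.tsum_le_tsum fun l => ?_
            rw [← mul_assoc]
            refine (mul_le_mul_left (h₁ i j k l h) _).trans (le_of_eq ?_)
            simp only [ha, hd]
            ring
    calc _ ≤ ENNReal.ofReal ((2 : ℝ) ^ ((k : ℝ) * α)) * ∑' i, ∑' j, ‖u j (phaseLocalization
          (fatDyadic φ₀ j) (dyadic ψ₀ k) (SchwartzMap.smulLeftCLM ℂ (dyadic φ₀ i) w))‖ₑ :=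
        mul_le_mul_right (enorm_fourierMultiplierCLM_fourier_apply_le hφ f _ w) _
      _ ≤ ENNReal.ofReal C₁ * ∑' i, d i * e k i := by
        have hsum' := ENNReal.tsum_le_tsum fun i => ENNReal.tsum_le_tsum fun j => hterm i j
        simpa only [he, ENNReal.tsum_mul_left] using hsum'
      _ ≤ ENNReal.ofReal C₁ * ((ENNReal.ofReal C₂ * eLpNorm h 2 volume)
          * (∑' i, e k i ^ 2) ^ (1 / 2 : ℝ)) := by
        refine mul_le_mul_right ((tsum_mul_le_sqrt_mul_sqrt d (e k)).trans ?_) _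
        exact mul_le_mul_left (h₂ h) _
      _ = _ := by
        rw [ENNReal.ofReal_mul hC₁]
        ring
  have hsq : ∑' k : ℕ, (ENNReal.ofReal ((2 : ℝ) ^ ((k : ℝ) * α)) * weightedL2Norm s
      (TemperedDistribution.fourierMultiplierCLM ℂ (dyadic ψ₀ k) (𝓕 f))) ^ 2
        ≤ ENNReal.ofReal (C₁ * C₂ * 9) ^ 2 * ∑' j : ℕ,
          (ENNReal.ofReal ((2 : ℝ) ^ ((j : ℝ) * s)) * weightedL2Norm α (u j)) ^ 2 := by
    calc _ ≤ ∑' k, ENNReal.ofReal (C₁ * C₂) ^ 2 * ∑' i, e k i ^ 2 := by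
          refine ENNReal.tsum_le_tsum fun k => (pow_le_pow_left' (hk k) 2).trans (le_of_eq ?_)
          rw [mul_pow, rpow_half_sq]
      _ ≤ ENNReal.ofReal (C₁ * C₂) ^ 2 * (81 * ∑' j, ∑' l, a j l ^ 2) := by
          rw [ENNReal.tsum_mul_left]
          exact mul_le_mul_right (tsum_sq_tsum_dyadicDecay_le a) _
      _ ≤ ENNReal.ofReal (C₁ * C₂) ^ 2 * (81 * ∑' j : ℕ,
          (ENNReal.ofReal ((2 : ℝ) ^ ((j : ℝ) * s)) * weightedL2Norm α (u j)) ^ 2) := by gcongr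
      _ = _ := by
          rw [ENNReal.ofReal_mul (p := C₁ * C₂) (by positivity), mul_pow, ← mul_assoc]
          norm_num
  calc sobolevNorm ψ₀ α s (𝓕 f)
      ≤ (ENNReal.ofReal (C₁ * C₂ * 9) ^ 2 * ∑' j : ℕ,
          (ENNReal.ofReal ((2 : ℝ) ^ ((j : ℝ) * s)) * weightedL2Norm α (u j)) ^ 2) ^ (1 / 2 : ℝ) :=
        ENNReal.rpow_le_rpow hsq (by norm_num)
    _ = ENNReal.ofReal (C₁ * C₂ * 9) * sobolevNorm φ₀ s α f := by
        rw [ENNReal.mul_rpow_of_nonneg _ _ (by norm_num), ← ENNReal.rpow_natCast,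
          ← ENNReal.rpow_mul, sobolevNorm]
        norm_num [hu]
    _ ≤ _ := by
        gcongr
        linarith

/-! ### The Fourier transform is an isomorphism -/

/-- The Fourier transform has order four. -/
theorem fourier_fourier_fourier_eq_fourierInv (f : 𝓢'(EuclideanSpace ℝ (Fin n), ℂ)) :
    𝓕 (𝓕 (𝓕 f)) = 𝓕⁻ f := by
  ext h
  have h1 : 𝓕 (𝓕 (𝓕 (𝓕 (𝓕⁻ h)))) = 𝓕⁻ h := by
    ext x
    rw [fourier_fourier_apply, fourier_fourier_apply, neg_neg]
  rw [FourierTransform.fourier_fourierInv_eq] at h1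
  simp only [TemperedDistribution.fourier_apply, TemperedDistribution.fourierInv_apply, h1]

theorem exists_sobolevNorm_le_sobolevNorm_fourier {φ₀ ψ₀ : 𝓢(EuclideanSpace ℝ (Fin n), ℂ)}
    (hφ : IsDyadicGenerator φ₀) (hψ : IsDyadicGenerator ψ₀) (s α : ℝ) :
    ∃ C : ℝ, 0 < C ∧ ∀ f : 𝓢'(EuclideanSpace ℝ (Fin n), ℂ),
      sobolevNorm φ₀ s α f ≤ ENNReal.ofReal C * sobolevNorm ψ₀ α s (𝓕 f) := by
  obtain ⟨C, hC, h⟩ := exists_sobolevNorm_fourier_le hφ hψ s α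
  obtain ⟨D, hD, h'⟩ := exists_sobolevNorm_fourier_le hψ hφ α s
  refine ⟨D * (C * D), by positivity, fun f => ?_⟩
  -- The inverse Fourier transform is the third power of the Fourier transform.
  have h1 : f = 𝓕 (𝓕 (𝓕 (𝓕 f))) := by
    rw [fourier_fourier_fourier_eq_fourierInv, FourierTransform.fourierInv_fourier_eq]
  conv_lhs => rw [h1]
  exact le_ofReal_mul_trans hD.le (h' _) (le_ofReal_mul_trans hC.le (h _) (h' _))

theorem bijOn_fourier_sobolevSpace {φ₀ ψ₀ : 𝓢(EuclideanSpace ℝ (Fin n), ℂ)}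
    (hφ : IsDyadicGenerator φ₀) (hψ : IsDyadicGenerator ψ₀) (s α : ℝ) :
    Set.BijOn (fun f : 𝓢'(EuclideanSpace ℝ (Fin n), ℂ) => 𝓕 f)
      (sobolevSpace φ₀ s α) (sobolevSpace ψ₀ α s) := by
  obtain ⟨C, -, h⟩ := exists_sobolevNorm_fourier_le hφ hψ s α
  obtain ⟨D, -, h'⟩ := exists_sobolevNorm_le_sobolevNorm_fourier hφ hψ s α
  refine ⟨fun f hf => ?_, fun f _ g _ hfg => ?_, fun g hg => ?_⟩
  · exact (h f).trans_lt (ENNReal.mul_lt_top ENNReal.ofReal_lt_top hf)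
  · have h1 : 𝓕⁻ (𝓕 f) = 𝓕⁻ (𝓕 g) := congrArg _ hfg
    simpa only [FourierTransform.fourierInv_fourier_eq] using h1
  · have h1 : 𝓕 (𝓕⁻ g) = g := FourierTransform.fourier_fourierInv_eq g
    refine ⟨𝓕⁻ g, (h' _).trans_lt (ENNReal.mul_lt_top ENNReal.ofReal_lt_top ?_), h1⟩
    rw [h1]
    exact hg

end

end WeightedSobolev

theorem proposition1p1 (n : ℕ) (s α : ℝ)
    (φ₀ ψ₀ : 𝓢(EuclideanSpace ℝ (Fin n), ℂ))
    (hφ : WeightedSobolev.IsDyadicGenerator φ₀) (hψ : WeightedSobolev.IsDyadicGenerator ψ₀) :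
    -- the Fourier transform maps `H^s(w_α)` one-to-one onto `H^α(w_s)`
    Set.BijOn (fun f : 𝓢'(EuclideanSpace ℝ (Fin n), ℂ) => 𝓕 f)
      (WeightedSobolev.sobolevSpace φ₀ s α) (WeightedSobolev.sobolevSpace ψ₀ α s) ∧
    -- boundedly in both directions
    (∃ c C : ℝ, 0 < c ∧ 0 < C ∧ ∀ f ∈ WeightedSobolev.sobolevSpace φ₀ s α,
      ENNReal.ofReal c * WeightedSobolev.sobolevNorm φ₀ s α f
          ≤ WeightedSobolev.sobolevNorm ψ₀ α s (𝓕 f) ∧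
        WeightedSobolev.sobolevNorm ψ₀ α s (𝓕 f)
          ≤ ENNReal.ofReal C * WeightedSobolev.sobolevNorm φ₀ s α f) ∧
    -- in particular it maps `H^s(w_s)` onto itself
    (fun f : 𝓢'(EuclideanSpace ℝ (Fin n), ℂ) => 𝓕 f) '' (WeightedSobolev.sobolevSpace φ₀ s s)
      = WeightedSobolev.sobolevSpace φ₀ s s := by
  obtain ⟨C, hC, h⟩ := WeightedSobolev.exists_sobolevNorm_fourier_le hφ hψ s α
  obtain ⟨D, hD, h'⟩ := WeightedSobolev.exists_sobolevNorm_le_sobolevNorm_fourier hφ hψ s α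
  refine ⟨WeightedSobolev.bijOn_fourier_sobolevSpace hφ hψ s α,
    ⟨D⁻¹, C, inv_pos.2 hD, hC, fun f _ => ⟨?_, h f⟩⟩,
    (WeightedSobolev.bijOn_fourier_sobolevSpace hφ hφ s s).image_eq⟩
  calc _ ≤ ENNReal.ofReal D⁻¹ * (ENNReal.ofReal D
        * WeightedSobolev.sobolevNorm ψ₀ α s (𝓕 f)) := by gcongr; exact h' f
    _ = _ := by
      rw [← mul_assoc, ← ENNReal.ofReal_mul (inv_pos.2 hD).le, inv_mul_cancel₀ hD.ne',
        ENNReal.ofReal_one, one_mul]
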